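/- **Setting.** Let $d,k\ge 0$ and $N\ge 1$ be integers, $T>0$ and $[d]=\{1,\dots,d\}$. Let $\sigma_\mu\in C^{N-1}(\mathbb R^k,\mathbb R^k)$ for $\mu\in[d]$. *Trees and forests.* A forest is a finite multiset of rooted (non-planar) trees with nodes decorated by $[d]$, written as a commutative product, with $\mathbb 1$ the empty forest. $[f]_\mu$ is the tree obtained by joining all trees of the forest $f$ to a new root decorated by $\mu$; every tree is of this form in a unique way. $|f|$ is the number of nodes and $\#f$ the number of trees of $f$. $\mathring{\mathcal T}_{\le n}$ and $\mathcal F_{\le n}$ are the (finite) sets of trees, respectively forests, of order $|\cdot|\le n$. On the real span of all forests (an algebra for the forest product), $\langle f,a\rangle$ is the coefficient of $a$ at $f$, and $P_{\le n}$ is the linear projection annihilating the forests of order $>n$ and fixing the others. The coproduct $\Delta$ is the linear map with $\Delta\mathbb 1=\mathbb 1\otimes\mathbb 1$, $\Delta[f]_\mu=[f]_\mu\otimes\mathbb 1+(\mathrm{id}\otimes[\,\cdot\,]_\mu)\Delta f$ and $\Delta f=\prod_{h\in f}\Delta h$. The symmetry factor is given by $S(f)=\prod_h f_h!\,S(h)^{f_h}$,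 with $f_h$ the multiplicity of the tree $h$ in $f$, and $S([f]_\mu)=S(f)$. *Paths.* Let $\mathcal F$ be the set of forests all of whose trees have order $\le N$. A character path $\mathbf X$ assigns to every $(s,t)\in[0,T]^2$ a unital algebra homomorphism $\mathbf X_{s,t}:\mathrm{Span}(\mathcal F)\to\mathbb R$, whose value at $a$ is written $\langle\mathbf X_{s,t},a\rangle$; let $\langle\mathbf X_{s,t}\otimes f,a\otimes b\rangle=\langle\mathbf X_{s,t},a\rangle\langle f,b\rangle$. All operations are applied componentwise to $\mathrm{Span}^k$. For $\mathbf U:[0,T]\to\mathrm{Span}(\mathcal F_{\le N-1})^k$ and $f\in\mathcal F_{\le N-1}$ put $$R^{\mathbf U,f}_{s,t}=\langle f,\mathbf U_t\rangle-\langle\mathbf X_{s,t}\otimes f,\Delta\mathbf U_s\rangle\in\mathbb R^k .$$ A tree path is a map $\mathbf Y:[0,T]\to\mathrm{Span}(\mathring{\mathcal T}_{\le N-1}\cup\{\mathbb 1\})^k$; write $Y_s=\langle\mathbb 1,\mathbf Y_s\rangle\in\mathbb R^k$ and $\delta\mathbf Y_s=\mathbf Y_s-Y_s\mathbb 1$.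 For $Z\in\mathrm{Span}(\mathring{\mathcal T}_{\le N-1})^k$, a function $g:\mathbb R^k\to\mathbb R^k$ and $y\in\mathbb R^k$, let $$D^pg(y)[Z,\dots,Z]=\sum_{h_1,\dots,h_p\in\mathring{\mathcal T}_{\le N-1}}D^pg(y)\big[\langle h_1,Z\rangle,\dots,\langle h_p,Z\rangle\big]\,h_1\cdots h_p .$$ For $g\in C^{N-1}(\mathbb R^k,\mathbb R^k)$ let $$g(\mathbf Y)_s=g(Y_s)\mathbb 1+P_{\le N-1}\sum_{p=1}^{N-1}\frac1{p!}D^pg(Y_s)[\delta\mathbf Y_s,\dots,\delta\mathbf Y_s].$$ $\mathbf Y$ is *coherent* if $\langle f,\sigma_\mu(\mathbf Y)_s\rangle=\langle[f]_\mu,\mathbf Y_s\rangle$ for all $[f]_\mu\in\mathring{\mathcal T}_{\le N-1}$ and all $s\in(0,T]$. *Elementary differentials.* For $\mu\in[d]$, $f\in\mathcal F_{\le N-1}$, respectively $h=[f]_\mu\in\mathring{\mathcal T}_{\le N-1}$, define recursively $\Upsilon_\mu[f](y)=D^{\#f}\sigma_\mu(y)\big[(\Upsilon[h'](y))_{h'\in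 f}\big]$ and $\Upsilon[[f]_\mu]=\Upsilon_\mu[f]$; put $\boldsymbol\Upsilon_\mu[f]=\frac1{S(f)}\Upsilon_\mu[f]$, $\boldsymbol\Upsilon[h]=\frac1{S(h)}\Upsilon[h]$ and $\boldsymbol\Upsilon(y)=\sum_{h\in\mathring{\mathcal T}_{\le N-1}}\boldsymbol\Upsilon[h](y)\,h$. **Statement.** Let $\mathbf X$ be a character path and $\mathbf Y$ a coherent tree path. Then for all $f\in\mathcal F_{\le N-1}$, $\mu\in[d]$ and $s,t\in(0,T]$, $$R^{\sigma_\mu(\mathbf Y),f}_{s,t}=\boldsymbol\Upsilon_\mu[f](Y_t)-\Big\langle\mathbf X_{s,t},\,P_{\le N-|f|-1}\sum_{p=0}^{N-1}\frac1{p!}D^p\boldsymbol\Upsilon_\mu[f](Y_s)\big[\boldsymbol\Upsilon(Y_s),\dots,\boldsymbol\Upsilon(Y_s)\big]\Big\rangle .$$ (Every summand that involves a derivative of $\boldsymbol\Upsilon_\mu[f]$ of order $p>N-1-|f|$, which need not exist, is annihilated by $P_{\le N-|f|-1}$.) -/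

import Mathlib

open scoped TensorProduct

namespace BranchedRP

noncomputable section

/-! ### Decorated rooted trees and forests -/

/-- A tree is given by the decoration of its root (in `Fin d`) and the finite multiset of the
trees that are attached to the root; this is the corresponding functor. -/
def TreeF (d : ℕ) (α : Type) : Type := Fin d × Multiset α

instance instQPFTreeF (d : ℕ) : QPF (TreeF d) where
  map g x := (x.1, x.2.map g)
  P := ⟨Fin d × ℕ, fun a => Fin a.2⟩
  abs p := (p.1.1, (List.ofFn p.2 : Multiset _))
  repr x := ⟨(x.1, x.2.toList.length), x.2.toList.get⟩
  abs_repr x := by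
    refine Prod.ext rfl ?_
    change ((List.ofFn x.2.toList.get : List _) : Multiset _) = x.2
    rw [List.ofFn_get, Multiset.coe_toList]
  abs_map g p := by
    refine Prod.ext rfl ?_
    change ((List.ofFn (g ∘ p.2) : List _) : Multiset _)
      = Multiset.map g ((List.ofFn p.2 : List _) : Multiset _)
    rw [Multiset.map_coe, List.map_ofFn]

/-- Finite rooted trees (non-planar: the order of the branches is irrelevant) whose nodes carry
decorations in `Fin d`: the least type generated by `node` below. -/
def RTree (d : ℕ) : Type := QPF.Fix (TreeF d)

/-- A forest is a finite collection of trees, with multiplicities.  The forest product is the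
addition of multisets and the empty forest is `0`. -/
abbrev Forest (d : ℕ) : Type := Multiset (RTree d)

/-- The tree `[f]_μ` obtained by joining all trees of `f` to a new root with decoration `μ`. -/
def RTree.node {d : ℕ} (μ : Fin d) (f : Forest d) : RTree d :=
  QPF.Fix.mk (F := TreeF d) (μ, f)

/-- The decoration of the root: `root [f]_μ = μ`. -/
def RTree.root {d : ℕ} (h : RTree d) : Fin d := (QPF.Fix.dest (F := TreeF d) h).1

/-- The forest attached to the root: `children [f]_μ = f`. -/
def RTree.children {d : ℕ} (h : RTree d) : Forest d := (QPF.Fix.dest (F := TreeF d) h).2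

theorem RTree.root_node {d : ℕ} (μ : Fin d) (f : Forest d) : (RTree.node μ f).root = μ :=
  congrArg Prod.fst (QPF.Fix.dest_mk (F := TreeF d) (μ, f))

theorem RTree.children_node {d : ℕ} (μ : Fin d) (f : Forest d) :
    (RTree.node μ f).children = f :=
  congrArg Prod.snd (QPF.Fix.dest_mk (F := TreeF d) (μ, f))

theorem RTree.node_root_children {d : ℕ} (h : RTree d) : RTree.node h.root h.children = h :=
  QPF.Fix.mk_dest (F := TreeF d) h

/-- Structural induction on trees. -/
theorem RTree.induction {d : ℕ} {p : RTree d → Prop}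
    (step : ∀ (μ : Fin d) (f : Forest d), (∀ h ∈ f, p h) → p (RTree.node μ f)) (h : RTree d) :
    p h := by
  refine QPF.Fix.ind (F := TreeF d) p ?_ h
  rintro x ⟨u, hu⟩
  obtain ⟨μ, f⟩ := x
  obtain ⟨ν, g⟩ := u
  have h2 : g.map Subtype.val = f := congrArg Prod.snd hu
  refine step μ f fun t ht => ?_
  rw [← h2] at ht
  obtain ⟨y, -, rfl⟩ := Multiset.mem_map.1 ht
  exact y.2

/-- The order of a tree, i.e. its number of nodes: `|[f]_μ| = |f| + 1`. -/
def RTree.order {d : ℕ} : RTree d → ℕ :=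
  QPF.Fix.rec (F := TreeF d) (fun x => Multiset.sum x.2 + 1)

/-- The order of a forest: `|f| = ∑_{h ∈ f} |h|`. -/
def forestOrder {d : ℕ} (f : Forest d) : ℕ := (f.map RTree.order).sum

theorem RTree.order_node {d : ℕ} (μ : Fin d) (f : Forest d) :
    (RTree.node μ f).order = forestOrder f + 1 :=
  QPF.Fix.rec_eq (F := TreeF d) (fun x => Multiset.sum x.2 + 1) (μ, f)

theorem RTree.order_eq {d : ℕ} (h : RTree d) : h.order = forestOrder h.children + 1 := by
  conv_lhs => rw [← h.node_root_children]
  exact RTree.order_node _ _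

theorem RTree.order_le_forestOrder {d : ℕ} {h : RTree d} {f : Forest d} (hf : h ∈ f) :
    h.order ≤ forestOrder f :=
  Multiset.single_le_sum (fun _ _ => Nat.zero_le _) _ (Multiset.mem_map_of_mem _ hf)

theorem RTree.order_lt_of_mem_children {d : ℕ} {h h' : RTree d} (hh : h' ∈ h.children) :
    h'.order < h.order := by
  rw [h.order_eq]
  exact Nat.lt_succ_of_le (RTree.order_le_forestOrder hh)

theorem card_le_forestOrder {d : ℕ} (f : Forest d) : f.card ≤ forestOrder f := by
  have := Multiset.card_nsmul_le_sum (s := f.map RTree.order) (a := 1) (by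
    intro x hx
    obtain ⟨h, -, rfl⟩ := Multiset.mem_map.1 hx
    rw [h.order_eq]
    omega)
  simpa [forestOrder] using this

/-- If there are finitely many trees of order at most `n`, so there are forests. -/
theorem finite_forests_of_trees {d n : ℕ} (hn : {h : RTree d | h.order ≤ n}.Finite) :
    {f : Forest d | forestOrder f ≤ n}.Finite := by
  classical
  refine ((n • hn.toFinset.val).powerset.toFinset.finite_toSet).subset fun f hf => ?_
  simp only [Finset.mem_coe, Multiset.mem_toFinset, Multiset.mem_powerset]
  rw [Multiset.le_iff_count]
  intro h
  by_cases hm : h ∈ f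
  · have h1 : h ∈ hn.toFinset.val := by
      simpa using (RTree.order_le_forestOrder hm).trans hf
    rw [Multiset.count_nsmul, Multiset.count_eq_one_of_mem hn.toFinset.nodup h1, mul_one]
    exact (Multiset.count_le_card _ _).trans ((card_le_forestOrder f).trans hf)
  · rw [Multiset.count_eq_zero_of_notMem hm]
    exact Nat.zero_le _

theorem finite_trees (d n : ℕ) : {h : RTree d | h.order ≤ n}.Finite := by
  induction n with
  | zero =>
    refine Set.Finite.subset Set.finite_empty fun h hh => ?_
    have := h.order_eq
    simp only [Set.mem_ofPred_eq] at hh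
    omega
  | succ n ih =>
    refine ((Set.finite_univ (α := Fin d)).image2 RTree.node
      (finite_forests_of_trees ih)).subset fun h hh => ?_
    refine ⟨h.root, Set.mem_univ _, h.children, ?_, h.node_root_children⟩
    have := h.order_eq
    simp only [Set.mem_ofPred_eq] at hh ⊢
    omega

theorem finite_forests (d n : ℕ) : {f : Forest d | forestOrder f ≤ n}.Finite :=
  finite_forests_of_trees (finite_trees d n)

/-- The finite set of all trees of order at most `n`. -/
def treesLE (d n : ℕ) : Finset (RTree d) := (finite_trees d n).toFinset

/-- The finite set of all forests of order at most `n`. -/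
def forestsLE (d n : ℕ) : Finset (Forest d) := (finite_forests d n).toFinset

open scoped Classical in
/-- The symmetry factor of a tree: `S([f]_μ) = S(f) = ∏_h f_h! S(h)^{f_h}`, where `f_h` is the
multiplicity of `h` in `f`. -/
def RTree.symm {d : ℕ} (h : RTree d) : ℕ :=
  ∏ x ∈ h.children.toFinset.attach,
    (h.children.count x.1).factorial * RTree.symm x.1 ^ h.children.count x.1
termination_by h.order
decreasing_by exact RTree.order_lt_of_mem_children (Multiset.mem_toFinset.1 x.2)

open scoped Classical in
/-- The symmetry factor of a forest: `S(f) = ∏_h f_h! S(h)^{f_h}`. -/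
def forestSymm {d : ℕ} (f : Forest d) : ℕ :=
  ∏ h ∈ f.toFinset, (f.count h).factorial * h.symm ^ f.count h

theorem RTree.symm_eq {d : ℕ} (h : RTree d) : h.symm = forestSymm h.children := by
  classical
  rw [RTree.symm, forestSymm]
  rw [← Finset.prod_attach h.children.toFinset]

/-! ### The linear span of the forests and the Connes-Kreimer coproduct -/

/-- `Span(F_all)`: finite formal real linear combinations of forests, a commutative algebra for
the (bilinearly extended) forest product. -/
abbrev ForestAlg (d : ℕ) : Type := AddMonoidAlgebra ℝ (Forest d)

/-- A forest, as an element of the span. -/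
def ofForest {d : ℕ} (f : Forest d) : ForestAlg d := AddMonoidAlgebra.single f 1

/-- A tree, as an element of the span. -/
def ofTree {d : ℕ} (h : RTree d) : ForestAlg d := ofForest {h}

/-- The linear extension of a map defined on forests. -/
def linExt {d : ℕ} {M : Type} [AddCommGroup M] [Module ℝ M] (φ : Forest d → M) :
    ForestAlg d →ₗ[ℝ] M :=
  Finsupp.linearCombination ℝ φ ∘ₗ
    (AddMonoidAlgebra.coeffLinearEquiv (S := ℝ) (M := Forest d) ℝ).toLinearMap

theorem linExt_ofForest {d : ℕ} {M : Type} [AddCommGroup M] [Module ℝ M] (φ : Forest d → M)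
    (f : Forest d) : linExt φ (ofForest f) = φ f := by
  simp [linExt, ofForest]

open scoped Classical in
/-- The coefficient `⟨f, a⟩` of `a` at the forest `f`. -/
def coef {d : ℕ} (f : Forest d) : ForestAlg d →ₗ[ℝ] ℝ :=
  linExt fun g => if g = f then 1 else 0

/-- The projection `P_{≤ n}`: it annihilates the forests of order `> n` and fixes the others. -/
def proj {d : ℕ} (n : ℕ) : ForestAlg d →ₗ[ℝ] ForestAlg d :=
  linExt fun f => if forestOrder f ≤ n then ofForest f else 0

/-- The linear extension of `f ↦ [f]_μ`. -/
def graftRoot {d : ℕ} (μ : Fin d) : ForestAlg d →ₗ[ℝ] ForestAlg d :=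
  linExt fun f => ofTree (RTree.node μ f)

/-- The coproduct of a tree:
`Δ [f]_μ = [f]_μ ⊗ 1 + (id ⊗ [·]_μ) Δ f`, with `Δ f = ∏_{h ∈ f} Δ h`. -/
def RTree.coproduct {d : ℕ} (h : RTree d) : ForestAlg d ⊗[ℝ] ForestAlg d :=
  ofTree h ⊗ₜ[ℝ] 1 +
    TensorProduct.map LinearMap.id (graftRoot h.root)
      (h.children.attach.map fun x => RTree.coproduct x.1).prod
termination_by h.order
decreasing_by exact RTree.order_lt_of_mem_children x.2

/-- The coproduct of a forest: `Δ f = ∏_{h ∈ f} Δ h`. -/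
def forestCoproduct {d : ℕ} (f : Forest d) : ForestAlg d ⊗[ℝ] ForestAlg d :=
  (f.map RTree.coproduct).prod

/-- The coproduct on the span of all forests. -/
def coproduct {d : ℕ} : ForestAlg d →ₗ[ℝ] ForestAlg d ⊗[ℝ] ForestAlg d :=
  linExt forestCoproduct

theorem RTree.coproduct_node {d : ℕ} (μ : Fin d) (f : Forest d) :
    (RTree.node μ f).coproduct = ofTree (RTree.node μ f) ⊗ₜ[ℝ] 1 +
      TensorProduct.map LinearMap.id (graftRoot μ) (forestCoproduct f) := by
  rw [RTree.coproduct, RTree.root_node, Multiset.attach_map_val' _ RTree.coproduct,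
    RTree.children_node, forestCoproduct]

/-! ### Characters -/

/-- The set `F` of forests all of whose trees have order at most `N`; it is closed under the
forest product. -/
def boundedForests (d N : ℕ) : AddSubmonoid (Forest d) where
  carrier := {f | ∀ h ∈ f, h.order ≤ N}
  zero_mem' := by simp
  add_mem' := by
    intro a b ha hb h hh
    rcases Multiset.mem_add.1 hh with h1 | h1
    · exact ha h h1
    · exact hb h h1

/-- Real characters on `Span(F)`: algebra homomorphisms from `Span(F)` to `ℝ`. -/
abbrev Character (d N : ℕ) : Type := AddMonoidAlgebra ℝ (boundedForests d N) →ₐ[ℝ] ℝ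

open scoped Classical in
/-- The duality pairing `⟨u, a⟩` of a character `u` on `Span(F)` with `a`.  It is the honest
pairing for `a ∈ Span(F)`; only such `a` are ever paired with a character below (for forests
outside `F`, where `u` is not defined, the value is set to `0`). -/
def Character.pair {d N : ℕ} (u : Character d N) : ForestAlg d →ₗ[ℝ] ℝ :=
  linExt fun f => if hf : f ∈ boundedForests d N then u (AddMonoidAlgebra.single ⟨f, hf⟩ 1) else 0

/-- The functional `u ⊗ f` on tensors: `⟨u ⊗ f, a ⊗ b⟩ = ⟨u, a⟩ ⟨f, b⟩`. -/
def Character.pairTensor {d N : ℕ} (u : Character d N) (f : Forest d) :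
    ForestAlg d ⊗[ℝ] ForestAlg d →ₗ[ℝ] ℝ :=
  LinearMap.mul' ℝ ℝ ∘ₗ TensorProduct.map u.pair (coef f)

/-- A character path on `[0,T]`. -/
abbrev CharacterPath (d N : ℕ) (T : ℝ) : Type :=
  Set.Icc (0 : ℝ) T → Set.Icc (0 : ℝ) T → Character d N

/-! ### Vector-valued expansions -/

/-- The state space `ℝ^k`. -/
abbrev State (k : ℕ) : Type := EuclideanSpace ℝ (Fin k)

/-- `Span(F_all)^k`. -/
abbrev VecAlg (d k : ℕ) : Type := Fin k → ForestAlg d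

/-- The element `v a` of `Span(F_all)^k`, for `v ∈ ℝ^k` and `a ∈ Span(F_all)`. -/
def vecSmul {d k : ℕ} (v : State k) (a : ForestAlg d) : VecAlg d k := fun j => v j • a

/-- The componentwise application of a linear functional: `Span(F_all)^k → ℝ^k`. -/
def applyVec {d k : ℕ} (φ : ForestAlg d →ₗ[ℝ] ℝ) (Z : VecAlg d k) : State k :=
  WithLp.toLp 2 fun j => φ (Z j)

/-- The componentwise projection `P_{≤ n}` on `Span(F_all)^k`. -/
def projVec {d k : ℕ} (n : ℕ) (Z : VecAlg d k) : VecAlg d k := fun j => proj n (Z j)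

/-- `Z` is a linear combination of the empty forest and of trees of order at most `n`. -/
def IsTreeValued {d k : ℕ} (n : ℕ) (Z : VecAlg d k) : Prop :=
  ∀ j, Z j ∈ Submodule.span ℝ
    (insert 1 (ofTree '' {h : RTree d | h.order ≤ n}) : Set (ForestAlg d))

/-- `Y = ⟨𝟙, Z⟩ ∈ ℝ^k`, the coefficient of the empty forest. -/
def base {d k : ℕ} (Z : VecAlg d k) : State k := applyVec (coef 0) Z

/-- `δZ = Z - ⟨𝟙, Z⟩ 𝟙`. -/
def delta {d k : ℕ} (Z : VecAlg d k) : VecAlg d k := Z - vecSmul (base Z) 1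

/-- `D^p g(y)[(Z, …, Z)]` for `Z` in the span of the trees of order at most `n`, where the
`p`-linear form `D^p g(y)` on `ℝ^k` is viewed as a `p`-linear form on that span:
`∑_{h₁, …, h_p} D^p g(y)[(⟨h₁, Z⟩, …, ⟨h_p, Z⟩)] h₁ ⋯ h_p`. -/
def derivExpansion {d k : ℕ} (n p : ℕ) (g : State k → State k) (y : State k) (Z : VecAlg d k) :
    VecAlg d k :=
  ∑ h ∈ Fintype.piFinset fun _ : Fin p => treesLE d n,
    vecSmul (iteratedFDeriv ℝ p g y fun i => applyVec (coef {h i}) Z) (∏ i, ofTree (h i))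

/-- The composition of a function `g` with a tree-valued `Z`:
`g(Z) = g(Y) 𝟙 + P_{≤ N-1} ∑_{p=1}^{N-1} (1/p!) D^p g(Y)[(δZ, …, δZ)]` with `Y = ⟨𝟙, Z⟩`. -/
def compose {d k : ℕ} (N : ℕ) (g : State k → State k) (Z : VecAlg d k) : VecAlg d k :=
  vecSmul (g (base Z)) 1 +
    projVec (N - 1) (∑ p ∈ Finset.Icc 1 (N - 1),
      ((p.factorial : ℝ)⁻¹) • derivExpansion (N - 1) p g (base Z) (delta Z))

/-- The remainder `R^{Y,f}_{s,t} = ⟨f, Y_t⟩ - ⟨X_{s,t} ⊗ f, Δ Y_s⟩ ∈ ℝ^k` of a path `Y` in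
`Span(F_all)^k`. -/
def remainder {d k N : ℕ} {T : ℝ} (X : CharacterPath d N T)
    (Y : Set.Icc (0 : ℝ) T → VecAlg d k) (f : Forest d) (s t : Set.Icc (0 : ℝ) T) : State k :=
  applyVec (coef f) (Y t) - applyVec ((X s t).pairTensor f ∘ₗ coproduct) (Y s)

/-- A tree path: a path with values in `Span(T_{≤ N-1})^k`. -/
def IsTreePath {d k : ℕ} {T : ℝ} (N : ℕ) (Y : Set.Icc (0 : ℝ) T → VecAlg d k) : Prop :=
  ∀ s, IsTreeValued (N - 1) (Y s)

/-- Coherence of a tree path: `⟨f, σ_μ(Y_s)⟩ = ⟨[f]_μ, Y_s⟩` for every tree `[f]_μ` of order at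
most `N - 1` and every `s ∈ (0, T]`. -/
def IsCoherent {d k : ℕ} {T : ℝ} (N : ℕ) (σ : Fin d → State k → State k)
    (Y : Set.Icc (0 : ℝ) T → VecAlg d k) : Prop :=
  ∀ (μ : Fin d) (f : Forest d), RTree.node μ f ∈ treesLE d (N - 1) →
    ∀ s : Set.Icc (0 : ℝ) T, 0 < (s : ℝ) →
      applyVec (coef f) (compose N (σ μ) (Y s)) = applyVec (coef {RTree.node μ f}) (Y s)

/-! ### Elementary differentials -/

/-- `D^{#m} g(y)[(v)_{v ∈ m}]` for a finite family `m` of vectors, counted with multiplicity.  The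
vectors are inserted in some order, which does not matter when `g` is `#m` times continuously
differentiable. -/
def symDeriv {k : ℕ} (g : State k → State k) (y : State k) (m : Multiset (State k)) : State k :=
  iteratedFDeriv ℝ m.toList.length g y m.toList.get

/-- The elementary differential of a tree, `Υ[[f]_μ](y) = D^{#f} σ_μ(y)[(Υ[h](y))_{h ∈ f}]`. -/
def RTree.elemDiff {d k : ℕ} (σ : Fin d → State k → State k) (h : RTree d) (y : State k) :
    State k :=
  symDeriv (σ h.root) y (h.children.attach.map fun x => RTree.elemDiff σ x.1 y)
termination_by h.order
decreasing_by exact RTree.order_lt_of_mem_children x.2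

/-- The elementary differential of a forest,
`Υ_μ[f](y) = D^{#f} σ_μ(y)[(Υ[h](y))_{h ∈ f}]`. -/
def forestElemDiff {d k : ℕ} (σ : Fin d → State k → State k) (μ : Fin d) (f : Forest d)
    (y : State k) : State k :=
  symDeriv (σ μ) y (f.map fun h => h.elemDiff σ y)

theorem RTree.elemDiff_node {d k : ℕ} (σ : Fin d → State k → State k) (μ : Fin d)
    (f : Forest d) : (RTree.node μ f).elemDiff σ = forestElemDiff σ μ f := by
  funext y
  rw [RTree.elemDiff, RTree.root_node,
    Multiset.attach_map_val' _ (fun x : RTree d => RTree.elemDiff σ x y),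
    RTree.children_node, forestElemDiff]

/-- `𝚼_μ[f] = S(f)⁻¹ Υ_μ[f]`. -/
def boldUpsilonForest {d k : ℕ} (σ : Fin d → State k → State k) (μ : Fin d) (f : Forest d)
    (y : State k) : State k :=
  ((forestSymm f : ℝ)⁻¹) • forestElemDiff σ μ f y

/-- `𝚼[h] = S(h)⁻¹ Υ[h]`. -/
def boldUpsilonTree {d k : ℕ} (σ : Fin d → State k → State k) (h : RTree d) (y : State k) :
    State k :=
  ((h.symm : ℝ)⁻¹) • h.elemDiff σ y

/-- `𝚼(y) = ∑_h 𝚼[h](y) h`, the sum over all trees `h` of order at most `N - 1`. -/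
def boldUpsilon {d k : ℕ} (N : ℕ) (σ : Fin d → State k → State k) (y : State k) : VecAlg d k :=
  ∑ h ∈ treesLE d (N - 1), vecSmul (boldUpsilonTree σ h y) (ofTree h)

end

end BranchedRP

open BranchedRP

/-! Coherence forces every coefficient of `Y s`: by induction on trees, the coefficient at `h` is
`𝚼[h](Y_s)`, and that of `σ_μ(Y)_s` at a forest `g` is `𝚼_μ[g](Y_s)` (`IsCoherent.coef_tree`,
`coef_taylorLift`). The theorem thereby becomes an identity at one point `y`: for every character
`x`, `∑_{|g| ≤ n} ⟨x ⊗ f, Δg⟩ 𝚼_μ[g](y)` is the pairing of `x` with the truncated Taylor lift of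
`𝚼_μ[f]` along `𝚼(y)`, where `n = N - 1`. This is `coproductCoef_eq_liftEval`.

The identity is proved analytically, in the spirit of B-series, so that no combinatorics of cuts is
needed. Put `Φ_x(y) = y + ∑_h x(h) 𝚼[h](y)` (`shift`) and dilate characters by `r ^ |h|`. Taylor's
formula says that `g(Φ_x(y))` agrees up to `o(r ^ M)` with `x` applied to the truncated lift of `g`,
uniformly enough that `y` may move with `r` (`isLittleO_shift_sub_eval`). By strong induction on
`n`, the identity at lower orders and the recursion for `Δ[f]_μ` give `Φ_{x*z} = Φ_z ∘ Φ_x + o(r ^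
n)`, with `x * z` the convolution (`isLittleO_shift_convVal`). Applying `σ_μ` to both sides and
expanding in two ways yields `∑_g (x*z)(g) 𝚼_μ[g](y)` on one side and `∑_f z(f) 𝚼_μ[f](Φ_x(y))`,
hence `∑_f z(f)` times the lift of `𝚼_μ[f]`, on the other.

Since `Δ` preserves the total order, the difference of the two sums is a polynomial in `r` of degree
at most `n`. Being `o(r ^ n)`, it vanishes identically (`IsPolyLE.eq_zero_of_isLittleO`). At `r = 1`
the result holds for all `z`, and comparing coefficients of `z(f)` gives the identity for each `f`.
-/

namespace BranchedRP

open Filter Topology Asymptotics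

/-! ### Iterated directional derivatives and their symmetry -/

section Calculus

variable {E F : Type} [NormedAddCommGroup E] [NormedSpace ℝ E] [NormedAddCommGroup F]
  [NormedSpace ℝ F]

/-- The iterated directional derivative along the vectors of a list. -/
noncomputable def dirDeriv (g : E → F) : List E → E → F
  | [] => g
  | v :: l => fun y => fderiv ℝ (dirDeriv g l) y v

theorem contDiff_dirDeriv {g : E → F} (l : List E) (n : ℕ)
    (hg : ContDiff ℝ ((n + l.length : ℕ) : WithTop ℕ∞) g) :
    ContDiff ℝ (n : WithTop ℕ∞) (dirDeriv g l) := by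
  induction l generalizing n with
  | nil => simpa [dirDeriv] using hg
  | cons v l ih =>
    have h1 : ContDiff ℝ ((n + 1 : ℕ) : WithTop ℕ∞) (dirDeriv g l) := by
      apply ih
      rw [List.length_cons] at hg
      convert hg using 2
      omega
    have h2 : ContDiff ℝ (n : WithTop ℕ∞) (fderiv ℝ (dirDeriv g l)) :=
      h1.fderiv_right (by push_cast; rfl)
    exact h2.clm_apply contDiff_const

/-- Adjacent swaps generate all permutations, and a swap at the head is the symmetry of the second
derivative. Differentiating along the remaining vectors leaves exactly the two derivatives that this
symmetry needs. -/
theorem dirDeriv_perm {g : E → F} {l l' : List E} (h : l.Perm l')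
    (hg : ContDiff ℝ (l.length : WithTop ℕ∞) g) : dirDeriv g l = dirDeriv g l' := by
  induction h with
  | nil => rfl
  | cons v _ ih =>
    have := ih (hg.of_le (by simp))
    simp only [dirDeriv, this]
  | swap v w l =>
    have h2 : ContDiff ℝ ((2 : ℕ) : WithTop ℕ∞) (dirDeriv g l) := by
      apply contDiff_dirDeriv
      convert hg using 2
      simp
      omega
    have hd : ContDiff ℝ ((1 : ℕ) : WithTop ℕ∞) (fderiv ℝ (dirDeriv g l)) :=
      h2.fderiv_right (by norm_num)
    have hdiff : Differentiable ℝ (fderiv ℝ (dirDeriv g l)) := hd.differentiable (by norm_num)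
    funext y
    have hs : IsSymmSndFDerivAt ℝ (dirDeriv g l) y :=
      h2.contDiffAt.isSymmSndFDerivAt (by simp)
    have key : ∀ a b : E, fderiv ℝ (fun x => fderiv ℝ (dirDeriv g l) x a) y b =
        fderiv ℝ (fderiv ℝ (dirDeriv g l)) y b a := by
      intro a b
      rw [fderiv_clm_apply (hdiff y) (differentiableAt_const a)]
      simp
    simp only [dirDeriv]
    rw [key, key]
    exact hs.eq _ _
  | trans h1 h2 ih1 ih2 =>
    rw [ih1 hg, ih2 (by rwa [← h1.length_eq])]

theorem iteratedFDeriv_eq_dirDeriv {g : E → F} {p : ℕ} (hg : ContDiff ℝ (p : WithTop ℕ∞) g)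
    (v : Fin p → E) (y : E) : iteratedFDeriv ℝ p g y v = dirDeriv g (List.ofFn v) y := by
  induction p generalizing y with
  | zero => simp [dirDeriv]
  | succ p ih =>
    have hd : DifferentiableAt ℝ (iteratedFDeriv ℝ p g) y :=
      (hg.differentiable_iteratedFDeriv (by exact_mod_cast Nat.lt_succ_self p)) y
    have h1 : ∀ x, iteratedFDeriv ℝ p g x (Fin.tail v) = dirDeriv g (List.ofFn (Fin.tail v)) x :=
      fun x => ih (hg.of_le (by exact_mod_cast Nat.le_succ p)) _ x
    rw [iteratedFDeriv_succ_apply_left, List.ofFn_succ, dirDeriv]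
    have h2 : dirDeriv g (List.ofFn fun i : Fin p => v i.succ) =
        fun x => iteratedFDeriv ℝ p g x (Fin.tail v) := funext fun x => (h1 x).symm
    have h3 := (hd.hasFDerivAt.continuousMultilinear_apply_const (Fin.tail v)).fderiv
    simp only [h2, h3]
    rfl

end Calculus

/-- `symDeriv` inserts the vectors in an arbitrary chosen order; symmetry of the derivative allows
any enumeration to be used instead. -/
theorem symDeriv_eq_iteratedFDeriv {k p : ℕ} {g : State k → State k}
    (hg : ContDiff ℝ (p : WithTop ℕ∞) g) (v : Fin p → State k) (y : State k) :
    symDeriv g y (Finset.univ.val.map v) = iteratedFDeriv ℝ p g y v := by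
  have hperm : (Finset.univ.val.map v).toList.Perm (List.ofFn v) := by
    rw [← Multiset.coe_eq_coe, Multiset.coe_toList]
    exact (Fin.univ_val_map v)
  have hlen : (Finset.univ.val.map v).toList.length = p := by
    rw [hperm.length_eq, List.length_ofFn]
  rw [symDeriv, iteratedFDeriv_eq_dirDeriv (by rwa [hlen]), iteratedFDeriv_eq_dirDeriv hg,
    List.ofFn_get, dirDeriv_perm hperm (by rwa [hlen])]

/-! ### Taylor expansions at a moving base point -/

section Taylor

variable {E : Type} [NormedAddCommGroup E] [NormedSpace ℝ E]

/-- Taylor's formula with a little-o remainder that is uniform in the base point. -/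
theorem exists_taylor_bound (M : ℕ) {F : Type} [NormedAddCommGroup F] [NormedSpace ℝ F]
    {g : E → F} (hg : ContDiff ℝ (M : WithTop ℕ∞) g) (y : E) {ε : ℝ} (hε : 0 < ε) :
    ∃ δ > 0, ∀ a b : E, ‖a - y‖ < δ → ‖b‖ < δ →
      ‖g (a + b) - ∑ p ∈ Finset.range (M + 1),
        ((p.factorial : ℝ)⁻¹) • iteratedFDeriv ℝ p g a fun _ => b‖ ≤ ε * ‖b‖ ^ M := by
  induction M generalizing F with
  | zero =>
    have hc : ContinuousAt g y := hg.continuous.continuousAt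
    obtain ⟨δ, hδ, h⟩ := Metric.continuousAt_iff.1 hc (ε / 2) (half_pos hε)
    refine ⟨δ / 2, half_pos hδ, fun a b ha hb => ?_⟩
    have h1 := @h a (by rw [dist_eq_norm]; linarith)
    have h2 := @h (a + b) (by
      rw [dist_eq_norm, add_sub_right_comm]
      exact (norm_add_le _ _).trans_lt (by linarith))
    simp only [zero_add, Finset.range_one, Finset.sum_singleton, Nat.factorial_zero, Nat.cast_one,
      inv_one, one_smul, iteratedFDeriv_zero_apply, pow_zero, mul_one]
    rw [← dist_eq_norm]
    have := dist_triangle_right (g (a + b)) (g a) (g y)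
    linarith
  | succ M ih =>
    have hg' : ContDiff ℝ (M : WithTop ℕ∞) (fderiv ℝ g) := hg.fderiv_right (by push_cast; rfl)
    have hgd : Differentiable ℝ g := hg.differentiable (by simp)
    obtain ⟨δ, hδ, h⟩ := ih hg'
    refine ⟨δ, hδ, fun a b ha hb => ?_⟩
    -- Along the segment, the derivative of the remainder of order `M + 1` of `g` is the remainder
    -- of order `M` of `fderiv ℝ g` with increment `t • b`, applied to `b`. The induction hypothesis
    -- bounds it, and the mean value inequality on `[0, 1]` concludes; hence the generalization over
    -- the target space.
    have hder : ∀ t : ℝ, HasDerivAt (fun t : ℝ => g (a + t • b) -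
        ∑ p ∈ Finset.range (M + 1 + 1),
          (t ^ p * (p.factorial : ℝ)⁻¹) • iteratedFDeriv ℝ p g a fun _ => b)
        ((fderiv ℝ g (a + t • b) - ∑ p ∈ Finset.range (M + 1),
          ((p.factorial : ℝ)⁻¹) • iteratedFDeriv ℝ p (fderiv ℝ g) a fun _ => t • b) b) t := by
      intro t
      have hline : HasDerivAt (fun t : ℝ => a + t • b) b t := by
        simpa using ((hasDerivAt_id t).smul_const b).const_add a
      have h1 := (hgd (a + t • b)).hasFDerivAt.comp_hasDerivAt t hline
      have h2 : HasDerivAt (fun t : ℝ => ∑ p ∈ Finset.range (M + 1 + 1),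
          (t ^ p * (p.factorial : ℝ)⁻¹) • iteratedFDeriv ℝ p g a fun _ => b)
          (∑ p ∈ Finset.range (M + 1 + 1),
            ((p * t ^ (p - 1)) * (p.factorial : ℝ)⁻¹) • iteratedFDeriv ℝ p g a fun _ => b) t :=
        HasDerivAt.fun_sum fun p _ => ((hasDerivAt_pow p t).mul_const _).smul_const _
      refine (h1.sub h2).congr_deriv ?_
      rw [sub_apply, sum_apply]
      congr 1
      rw [Finset.sum_range_succ']
      simp only [Nat.cast_zero, zero_mul, zero_smul, add_zero]
      refine Finset.sum_congr rfl fun p _ => ?_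
      rw [smul_apply, iteratedFDeriv_succ_apply_right,
        ContinuousMultilinearMap.map_smul_univ, smul_apply, smul_smul]
      simp only [Finset.prod_const, Finset.card_univ, Fintype.card_fin]
      congr 1
      have : ((p.factorial : ℝ)) ≠ 0 := by positivity
      rw [Nat.factorial_succ, Nat.add_sub_cancel]
      push_cast
      field_simp
    have hb1 := norm_image_sub_le_of_norm_deriv_le_segment_01'
      (fun t _ => (hder t).hasDerivWithinAt) (C := ε * ‖b‖ ^ (M + 1)) (fun t ht => by
        have htb : ‖t • b‖ ≤ ‖b‖ := by
          rw [norm_smul, Real.norm_of_nonneg ht.1]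
          exact mul_le_of_le_one_left (norm_nonneg _) ht.2.le
        refine (ContinuousLinearMap.le_opNorm _ _).trans ?_
        rw [pow_succ, ← mul_assoc]
        refine mul_le_mul_of_nonneg_right ?_ (norm_nonneg _)
        refine (h a (t • b) ha (htb.trans_lt hb)).trans ?_
        gcongr)
    have h0 : ∑ p ∈ Finset.range (M + 1 + 1),
        ((0 : ℝ) ^ p * (p.factorial : ℝ)⁻¹) • iteratedFDeriv ℝ p g a (fun _ => b) = g a := by
      rw [Finset.sum_eq_single 0]
      · simp
      · intro p _ hp
        simp [hp]
      · simp
    simpa [h0] using hb1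

theorem isLittleO_taylor {M : ℕ} {F : Type} [NormedAddCommGroup F] [NormedSpace ℝ F]
    {g : E → F} (hg : ContDiff ℝ (M : WithTop ℕ∞) g) {l : Filter ℝ} (hl : l ≤ 𝓝 0) {y : E}
    {a b : ℝ → E} (ha : Tendsto a l (𝓝 y)) (hb : b =O[l] fun r => r) :
    (fun r => g (a r + b r) - ∑ p ∈ Finset.range (M + 1),
      ((p.factorial : ℝ)⁻¹) • iteratedFDeriv ℝ p g (a r) fun _ => b r) =o[l] fun r => r ^ M := by
  have hb0 : Tendsto b l (𝓝 0) := hb.trans_tendsto (tendsto_id.mono_left hl)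
  refine IsLittleO.trans_isBigO ?_ (hb.norm_left.pow M)
  refine isLittleO_iff.2 fun ε hε => ?_
  obtain ⟨δ, hδ, h⟩ := exists_taylor_bound M hg y hε
  filter_upwards [Metric.tendsto_nhds.1 ha δ hδ, Metric.tendsto_nhds.1 hb0 δ hδ] with r h1 h2
  rw [dist_eq_norm] at h1 h2
  rw [sub_zero] at h2
  simpa using h _ _ h1 h2

/-- For `M = 0` continuity is enough; for `M ≥ 1` strict differentiability makes `g` Lipschitz near
`y`. -/
theorem isLittleO_perturb {M : ℕ} {F : Type} [NormedAddCommGroup F] [NormedSpace ℝ F]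
    {g : E → F} (hg : ContDiff ℝ (M : WithTop ℕ∞) g) {l : Filter ℝ} (hl : l ≤ 𝓝 0) {y : E}
    {a b : ℝ → E} (ha : Tendsto a l (𝓝 y)) (hb : (fun r => b r - a r) =o[l] fun r => r ^ M) :
    (fun r => g (b r) - g (a r)) =o[l] fun r => r ^ M := by
  cases M with
  | zero =>
    simp only [pow_zero] at hb ⊢
    have h0 : Tendsto (fun r => b r - a r) l (𝓝 0) := (isLittleO_one_iff ℝ).1 hb
    have hb' : Tendsto b l (𝓝 y) := by simpa using h0.add ha
    refine (isLittleO_one_iff ℝ).2 ?_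
    have hc := hg.continuous
    simpa using ((hc.tendsto y).comp hb').sub ((hc.tendsto y).comp ha)
  | succ M =>
    have h0 : Tendsto (fun r => b r - a r) l (𝓝 0) := by
      refine hb.isBigO.trans_tendsto ?_
      have : Tendsto (fun r : ℝ => r ^ (M + 1)) (𝓝 0) (𝓝 0) := by
        simpa using (continuous_pow (M + 1)).tendsto (0 : ℝ)
      exact this.mono_left hl
    have hb' : Tendsto b l (𝓝 y) := by simpa using h0.add ha
    have hs : HasStrictFDerivAt g (fderiv ℝ g y) y :=
      hg.contDiffAt.hasStrictFDerivAt (by simp)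
    have h2 := hs.isBigO_sub.comp_tendsto (hb'.prodMk_nhds ha)
    exact IsBigO.trans_isLittleO h2 hb

end Taylor

end BranchedRP

namespace BranchedRP

noncomputable section

/-! ### Evaluations of the forest algebra -/

variable {d k : ℕ}

theorem ofForest_zero : ofForest (0 : Forest d) = 1 := rfl

theorem ofForest_add (f g : Forest d) : ofForest (f + g) = ofForest f * ofForest g := by
  simp [ofForest, AddMonoidAlgebra.single_mul_single]

theorem ofForest_sum {ι : Type} (s : Finset ι) (h : ι → Forest d) :
    ofForest (∑ i ∈ s, h i) = ∏ i ∈ s, ofForest (h i) := by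
  classical
  induction s using Finset.induction_on with
  | empty => simp [ofForest_zero]
  | insert a s ha ih => rw [Finset.sum_insert ha, Finset.prod_insert ha, ofForest_add, ih]

theorem linearMap_ext {M : Type} [AddCommGroup M] [Module ℝ M] {φ ψ : ForestAlg d →ₗ[ℝ] M}
    (h : ∀ f, φ (ofForest f) = ψ (ofForest f)) : φ = ψ := by
  refine LinearMap.ext fun a => ?_
  have hsmul : ∀ (f : Forest d) (c : ℝ), φ (AddMonoidAlgebra.single f c) =
      ψ (AddMonoidAlgebra.single f c) := by
    intro f c
    have : (AddMonoidAlgebra.single f c : ForestAlg d) = c • ofForest f := by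
      simp [ofForest]
    rw [this, map_smul, map_smul, h]
  induction a using AddMonoidAlgebra.induction_linear with
  | zero => simp
  | add a b ha hb => rw [map_add, map_add, ha, hb]
  | single f c => exact hsmul f c

/-- The algebra homomorphism `f ↦ ∏_{h ∈ f} x h` into a commutative algebra. -/
def evalAlg {A : Type} [CommRing A] [Algebra ℝ A] (x : RTree d → A) : ForestAlg d →ₐ[ℝ] A :=
  AddMonoidAlgebra.lift ℝ A (Forest d)
    { toFun := fun f => (f.toAdd.map x).prod
      map_one' := by simp
      map_mul' := fun a b => by simp }

theorem evalAlg_ofForest {A : Type} [CommRing A] [Algebra ℝ A] (x : RTree d → A)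
    (f : Forest d) : evalAlg x (ofForest f) = (f.map x).prod := by
  rw [evalAlg, ofForest, AddMonoidAlgebra.lift_single, one_smul]
  rfl

theorem evalAlg_ofTree {A : Type} [CommRing A] [Algebra ℝ A] (x : RTree d → A)
    (h : RTree d) : evalAlg x (ofTree h) = x h := by
  simp [ofTree, evalAlg_ofForest]

/-- The forest algebra embeds into the polynomial ring with one variable per tree, where evaluation
at real points separates polynomials. -/
theorem eq_zero_of_evalAlg_eq_zero {a : ForestAlg d} (h : ∀ x : RTree d → ℝ, evalAlg x a = 0) :
    a = 0 := by
  classical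
  let toPoly : ForestAlg d →ₐ[ℝ] MvPolynomial (RTree d) ℝ := evalAlg MvPolynomial.X
  let back : MvPolynomial (RTree d) ℝ →ₐ[ℝ] ForestAlg d := MvPolynomial.aeval ofTree
  have hback : ∀ b, back (toPoly b) = b := by
    intro b
    have : back.toLinearMap ∘ₗ toPoly.toLinearMap = LinearMap.id := by
      refine linearMap_ext fun f => ?_
      change back (evalAlg MvPolynomial.X (ofForest f)) = ofForest f
      rw [evalAlg_ofForest, map_multiset_prod, Multiset.map_map]
      induction f using Multiset.induction_on with
      | empty => simp [ofForest_zero]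
      | cons t f ih =>
        rw [Multiset.map_cons, Multiset.prod_cons, ih, ← Multiset.singleton_add, ofForest_add]
        simp [back, ofTree]
    exact LinearMap.congr_fun this b
  have h0 : toPoly a = 0 := by
    refine MvPolynomial.funext fun x => ?_
    rw [map_zero, ← h x]
    have : (MvPolynomial.aeval (R := ℝ) x).toLinearMap ∘ₗ toPoly.toLinearMap =
        (evalAlg x).toLinearMap := by
      refine linearMap_ext fun f => ?_
      change MvPolynomial.aeval x (evalAlg MvPolynomial.X (ofForest f)) = evalAlg x (ofForest f)
      rw [evalAlg_ofForest, evalAlg_ofForest, map_multiset_prod, Multiset.map_map]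
      simp
    exact LinearMap.congr_fun this a
  rw [← hback a, h0, map_zero]

/-- The rescaling `h ↦ r ^ |h| x(h)`. -/
def scaleVal (r : ℝ) (x : RTree d → ℝ) (h : RTree d) : ℝ := r ^ h.order * x h

theorem evalAlg_scaleVal (r : ℝ) (x : RTree d → ℝ) (f : Forest d) :
    evalAlg (scaleVal r x) (ofForest f) = r ^ forestOrder f * evalAlg x (ofForest f) := by
  rw [evalAlg_ofForest, evalAlg_ofForest, forestOrder]
  have : (f.map (scaleVal r x)).prod = (f.map fun h => r ^ h.order).prod * (f.map x).prod :=
    Multiset.prod_map_mul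
  rw [this]
  clear this
  congr 1
  induction f using Multiset.induction_on with
  | empty => simp
  | cons t f ih => simp [pow_add, ih]

/-! ### Coefficients and projections -/

theorem forestOrder_add (f g : Forest d) :
    forestOrder (f + g) = forestOrder f + forestOrder g := by
  simp [forestOrder]

theorem forestOrder_zero : forestOrder (0 : Forest d) = 0 := rfl

theorem mem_forestsLE {n : ℕ} {f : Forest d} : f ∈ forestsLE d n ↔ forestOrder f ≤ n := by
  simp [forestsLE]

theorem mem_treesLE {n : ℕ} {h : RTree d} : h ∈ treesLE d n ↔ h.order ≤ n := by
  simp [treesLE]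

theorem coef_ofForest [DecidableEq (Forest d)] (f g : Forest d) :
    coef f (ofForest g) = if g = f then 1 else 0 := by
  rw [coef, linExt_ofForest]
  congr

theorem proj_ofForest (n : ℕ) (f : Forest d) :
    proj n (ofForest f) = if forestOrder f ≤ n then ofForest f else 0 :=
  linExt_ofForest _ _

theorem proj_eq_sum (n : ℕ) (a : ForestAlg d) :
    proj n a = ∑ f ∈ forestsLE d n, coef f a • ofForest f := by
  classical
  have : proj n = ∑ f ∈ forestsLE d n, (coef f).smulRight (ofForest f) := by
    refine linearMap_ext fun g => ?_
    rw [proj_ofForest, LinearMap.sum_apply]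
    simp only [LinearMap.smulRight_apply, coef_ofForest, ite_smul, one_smul, zero_smul]
    rw [Finset.sum_ite_eq]
    simp only [mem_forestsLE]
  rw [this, LinearMap.sum_apply]
  rfl

theorem coef_proj (n : ℕ) (f : Forest d) (a : ForestAlg d) :
    coef f (proj n a) = if forestOrder f ≤ n then coef f a else 0 := by
  classical
  rw [proj_eq_sum, map_sum]
  simp only [map_smul, coef_ofForest, smul_eq_mul, mul_ite, mul_one, mul_zero]
  rw [Finset.sum_ite_eq']
  simp only [mem_forestsLE]

theorem applyVec_add (φ : ForestAlg d →ₗ[ℝ] ℝ) (A B : VecAlg d k) :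
    applyVec φ (A + B) = applyVec φ A + applyVec φ B := by
  ext j; simp [applyVec]

theorem applyVec_smul (φ : ForestAlg d →ₗ[ℝ] ℝ) (c : ℝ) (A : VecAlg d k) :
    applyVec φ (c • A) = c • applyVec φ A := by
  ext j; simp [applyVec]

theorem applyVec_sum (φ : ForestAlg d →ₗ[ℝ] ℝ) {ι : Type} (s : Finset ι) (A : ι → VecAlg d k) :
    applyVec φ (∑ i ∈ s, A i) = ∑ i ∈ s, applyVec φ (A i) := by
  ext j; simp [applyVec]

theorem applyVec_vecSmul (φ : ForestAlg d →ₗ[ℝ] ℝ) (v : State k) (a : ForestAlg d) :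
    applyVec φ (vecSmul v a) = φ a • v := by
  ext j; simp [applyVec, vecSmul, mul_comm]

theorem applyVec_projVec (φ : ForestAlg d →ₗ[ℝ] ℝ) (n : ℕ) (A : VecAlg d k) :
    applyVec φ (projVec n A) = applyVec (φ ∘ₗ proj n) A := rfl

theorem applyVec_projVec_eq_sum (φ : ForestAlg d →ₗ[ℝ] ℝ) (n : ℕ) (A : VecAlg d k) :
    applyVec φ (projVec n A) =
      ∑ f ∈ forestsLE d n, φ (ofForest f) • applyVec (coef f) A := by
  ext j
  simp [applyVec, projVec, proj_eq_sum, mul_comm]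

/-! ### Counting the enumerations of a forest -/

theorem sum_singleton_eq_map {p : ℕ} (h : Fin p → RTree d) :
    (∑ i, ({h i} : Forest d)) = Finset.univ.val.map h := by
  have := Multiset.sum_map_singleton (Finset.univ.val.map h)
  rwa [Multiset.map_map] at this

theorem prod_ofTree {p : ℕ} (h : Fin p → RTree d) :
    ∏ i, ofTree (h i) = ofForest (Finset.univ.val.map h) := by
  rw [← sum_singleton_eq_map, ofForest_sum]
  rfl

/-- The coefficient of `f` in `(∑ x ∈ s, x) ^ #f` is computed twice: expanding the product counts
enumerations of `f`, while the multinomial theorem gives `#f! / ∏ f_h!`. -/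
theorem card_enumerations [DecidableEq (RTree d)] (s : Finset (RTree d)) (f : Forest d)
    (hf : ∀ h ∈ f, h ∈ s) :
    ((Fintype.piFinset fun _ : Fin f.card => s).filter
        fun h => Finset.univ.val.map h = f).card * ∏ h ∈ f.toFinset, (f.count h).factorial =
      f.card.factorial := by
  have h1 : coef f ((∑ x ∈ s, ofTree x) ^ f.card) =
      (((Fintype.piFinset fun _ : Fin f.card => s).filter
        fun h => Finset.univ.val.map h = f).card : ℝ) := by
    have : (∑ x ∈ s, ofTree x) ^ f.card =
        ∑ h ∈ Fintype.piFinset fun _ : Fin f.card => s, ∏ i, ofTree (h i) := by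
      rw [← Finset.prod_univ_sum]
      simp
    rw [this, map_sum]
    simp only [prod_ofTree, coef_ofForest]
    rw [Finset.sum_boole]
  have h2 : coef f ((∑ x ∈ s, ofTree x) ^ f.card) =
      (Nat.multinomial s (fun x => f.count x) : ℝ) := by
    rw [Finset.sum_pow_eq_sum_piAntidiag, map_sum]
    have hterm : ∀ c : RTree d → ℕ, coef f ((Nat.multinomial s c : ForestAlg d) *
        ∏ i ∈ s, ofTree i ^ c i) =
        if ∑ i ∈ s, c i • ({i} : Forest d) = f then (Nat.multinomial s c : ℝ) else 0 := by
      intro c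
      have : ∏ i ∈ s, ofTree i ^ c i = ofForest (∑ i ∈ s, c i • ({i} : Forest d)) := by
        rw [ofForest_sum]
        refine Finset.prod_congr rfl fun i _ => ?_
        have : ∀ n : ℕ, ofForest (n • ({i} : Forest d)) = ofTree i ^ n := by
          intro n
          induction n with
          | zero => simp [ofForest_zero]
          | succ n ih => rw [succ_nsmul, ofForest_add, ih, pow_succ, ofTree]
        rw [this]
      rw [this, ← nsmul_eq_mul, map_nsmul, coef_ofForest]
      simp
    rw [Finset.sum_congr rfl fun c _ => hterm c, Finset.sum_eq_single fun x => f.count x]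
    · rw [if_pos]
      rw [← Finset.sum_subset (fun x hx => hf x (Multiset.mem_toFinset.1 hx))
        (fun x _ hx => by
          beta_reduce
          rw [Multiset.count_eq_zero_of_notMem (fun h => hx (Multiset.mem_toFinset.2 h)),
            zero_smul])]
      exact Multiset.toFinset_sum_count_nsmul_eq f
    · intro c hc hne
      rw [if_neg]
      intro h
      apply hne
      funext x
      rw [← h, Multiset.count_sum']
      simp only [Multiset.count_nsmul, Multiset.count_singleton, mul_ite, mul_one, mul_zero]
      rw [Finset.sum_ite_eq]
      split_ifs with hx
      · rfl
      · by_contra hcx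
        exact hx ((Finset.mem_piAntidiag.1 hc).2 x hcx)
    · intro hn
      refine absurd (Finset.mem_piAntidiag.2 ⟨?_, fun x hx => ?_⟩) hn
      · exact Multiset.sum_count_eq_card hf
      · exact hf x (Multiset.count_ne_zero.1 hx)
  have h3 := h1.symm.trans h2
  rw [Nat.cast_inj] at h3
  rw [h3, mul_comm]
  have h4 := Nat.multinomial_spec s fun x => f.count x
  rw [Multiset.sum_count_eq_card hf] at h4
  rw [← h4]
  congr 1
  refine Finset.prod_subset (fun x hx => hf x (Multiset.mem_toFinset.1 hx)) fun x _ hx => ?_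
  rw [Multiset.count_eq_zero_of_notMem (fun h => hx (Multiset.mem_toFinset.2 h)),
    Nat.factorial_zero]

/-! ### The lift of a function to expansions -/

/-- The untruncated expansion `∑_{p < N} (1/p!) D^p g(y)[(Z, …, Z)]`. -/
def taylorLift (N : ℕ) (g : State k → State k) (y : State k) (Z : VecAlg d k) : VecAlg d k :=
  ∑ p ∈ Finset.range N, ((p.factorial : ℝ)⁻¹) • derivExpansion (N - 1) p g y Z

theorem applyVec_derivExpansion (φ : ForestAlg d →ₗ[ℝ] ℝ) (n p : ℕ) (g : State k → State k)
    (y : State k) (Z : VecAlg d k) :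
    applyVec φ (derivExpansion n p g y Z) =
      ∑ h ∈ Fintype.piFinset fun _ : Fin p => treesLE d n,
        φ (ofForest (Finset.univ.val.map h)) •
          iteratedFDeriv ℝ p g y fun i => applyVec (coef {h i}) Z := by
  simp only [derivExpansion, applyVec_sum, applyVec_vecSmul, prod_ofTree]

/-- The term `p = 0` absorbs `g(Y) 𝟙`, and `delta Z` differs from `Z` only at the empty forest,
which `derivExpansion` never reads. -/
theorem compose_eq_projVec {N : ℕ} (hN : 1 ≤ N) (g : State k → State k) (Z : VecAlg d k) :
    compose N g Z = projVec (N - 1) (taylorLift N g (base Z) Z) := by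
  obtain ⟨n, rfl⟩ : ∃ n, N = n + 1 := ⟨N - 1, by omega⟩
  have hδ : ∀ h : RTree d, applyVec (coef {h}) (delta Z) = applyVec (coef {h}) Z := by
    classical
    intro h
    have : delta Z = Z + (-1 : ℝ) • vecSmul (base Z) 1 := by simp [delta, sub_eq_add_neg]
    rw [this, applyVec_add, applyVec_smul, applyVec_vecSmul, ← ofForest_zero, coef_ofForest,
      if_neg (Multiset.singleton_ne_zero h).symm]
    simp
  have hexp : ∀ p, derivExpansion n p g (base Z) (delta Z) = derivExpansion n p g (base Z) Z := by
    intro p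
    simp only [derivExpansion, hδ]
  have h0 : derivExpansion n 0 g (base Z) Z = vecSmul (g (base Z)) 1 := by
    simp [derivExpansion]
  rw [compose, taylorLift]
  simp only [Nat.add_sub_cancel, hexp]
  have hpadd : ∀ A B : VecAlg d k, projVec n (A + B) = projVec n A + projVec n B := by
    intro A B; funext j; simp [projVec]
  rw [Finset.range_eq_Ico, Finset.sum_eq_sum_Ico_succ_bot (Nat.succ_pos n), hpadd, h0]
  congr 1
  · funext j
    simp [projVec, vecSmul, ← ofForest_zero, proj_ofForest, forestOrder_zero]

/-- This is where the symmetry factor arises. Only `p = #f` produces `f`, and its `#f! / ∏ f_h!`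
enumerations contribute equally by symmetry of the derivative. Together with `1/p!` and the factors
`1/S(h)` carried by `Z` this gives `1/S(f)`. -/
theorem coef_taylorLift {N : ℕ} {σ : Fin d → State k → State k} {μ : Fin d}
    (hσ : ContDiff ℝ ((N - 1 : ℕ) : WithTop ℕ∞) (σ μ)) {f : Forest d}
    (hf : forestOrder f < N) {y : State k} {Z : VecAlg d k}
    (hZ : ∀ h ∈ f, applyVec (coef {h}) Z = boldUpsilonTree σ h y) :
    applyVec (coef f) (taylorLift N (σ μ) y Z) = boldUpsilonForest σ μ f y := by
  classical
  have hcard := card_le_forestOrder f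
  rw [taylorLift, applyVec_sum, Finset.sum_eq_single f.card]
  · rw [applyVec_smul, applyVec_derivExpansion]
    have hterm : ∀ h : Fin f.card → RTree d,
        coef f (ofForest (Finset.univ.val.map h)) •
          iteratedFDeriv ℝ f.card (σ μ) y (fun i => applyVec (coef {h i}) Z) =
        if Finset.univ.val.map h = f then
          ((f.map fun h => (h.symm : ℝ)).prod)⁻¹ • forestElemDiff σ μ f y else 0 := by
      intro h
      rw [coef_ofForest, ite_smul, one_smul, zero_smul]
      split_ifs with hh
      · have h1 : ∀ i, applyVec (coef {h i}) Z =
            ((h i).symm : ℝ)⁻¹ • (h i).elemDiff σ y := fun i =>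
          hZ (h i) (by
            have : h i ∈ Finset.univ.val.map h :=
              Multiset.mem_map_of_mem _ (Finset.mem_univ i)
            rwa [hh] at this)
        simp only [h1]
        rw [ContinuousMultilinearMap.map_smul_univ,
          ← symDeriv_eq_iteratedFDeriv (hσ.of_le (by exact_mod_cast (by omega))), forestElemDiff,
          Finset.prod_inv_distrib]
        have h2 : ∀ {β : Type} (F : RTree d → β),
            f.map F = Finset.univ.val.map fun i => F (h i) := by
          intro β F
          conv_lhs => rw [← hh]
          rw [Multiset.map_map]
          rfl
        rw [h2, h2]
        rfl
      · rfl
    rw [Finset.sum_congr rfl fun h _ => hterm h, ← Finset.sum_filter, Finset.sum_const,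
      boldUpsilonForest, ← Nat.cast_smul_eq_nsmul ℝ, smul_smul, smul_smul]
    congr 1
    have hc := card_enumerations (treesLE d (N - 1)) f fun h hh =>
      mem_treesLE.2 ((RTree.order_le_forestOrder hh).trans (by omega))
    have hS : forestSymm f = (∏ h ∈ f.toFinset, (f.count h).factorial) *
        (f.map RTree.symm).prod := by
      rw [forestSymm, Finset.prod_mul_distrib, Finset.prod_multiset_map_count]
    have hP : ((∏ h ∈ f.toFinset, (f.count h).factorial : ℕ) : ℝ) ≠ 0 := by
      exact_mod_cast Finset.prod_ne_zero_iff.2 fun h _ => Nat.factorial_ne_zero _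
    rw [hS, ← hc]
    have hC : (((Fintype.piFinset fun _ : Fin f.card => treesLE d (N - 1)).filter
        fun h => Finset.univ.val.map h = f).card : ℝ) ≠ 0 := by
      intro h0
      rw [Nat.cast_eq_zero] at h0
      rw [h0, zero_mul] at hc
      exact Nat.factorial_ne_zero _ hc.symm
    have hm : (((f.map RTree.symm).prod : ℕ) : ℝ) = (f.map fun h => (h.symm : ℝ)).prod := by
      rw [Nat.cast_multiset_prod, Multiset.map_map]
      rfl
    push_cast [hm] at hP ⊢
    rw [mul_inv, mul_inv]
    field_simp
  · intro p _ hp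
    rw [applyVec_smul, applyVec_derivExpansion, Finset.sum_eq_zero, smul_zero]
    intro h _
    rw [coef_ofForest, if_neg, zero_smul]
    intro hh
    apply hp
    rw [← hh]
    simp
  · intro h
    exact absurd (Finset.mem_range.2 (by omega)) h

end

end BranchedRP

namespace BranchedRP

noncomputable section

open Filter Topology Asymptotics

variable {d k : ℕ}

/-! ### Asymptotics under dilation -/

theorem isBigO_pow_of_le {l : Filter ℝ} (hl : l ≤ 𝓝 0) {m n : ℕ} (h : m ≤ n) :
    (fun r : ℝ => r ^ n) =O[l] fun r => r ^ m :=
  IsBigO.of_bound 1 (Eventually.filter_mono hl (by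
    filter_upwards [Metric.ball_mem_nhds (0 : ℝ) one_pos] with r hr
    rw [one_mul, norm_pow, norm_pow]
    exact pow_le_pow_of_le_one (norm_nonneg _) (mem_ball_zero_iff.1 hr).le h))

theorem isBigO_scaleVal (x : RTree d → ℝ) (h : RTree d) (l : Filter ℝ) :
    (fun r => scaleVal r x h) =O[l] fun r => r ^ h.order := by
  simpa [scaleVal, mul_comm] using
    (isBigO_refl (fun r : ℝ => r ^ h.order) l).const_mul_left (x h)

theorem isBigO_evalAlg_scaleVal (x : RTree d → ℝ) (f : Forest d) (l : Filter ℝ) :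
    (fun r => evalAlg (scaleVal r x) (ofForest f)) =O[l] fun r => r ^ forestOrder f := by
  simp only [evalAlg_scaleVal, mul_comm _ (evalAlg x (ofForest f))]
  exact (isBigO_refl (fun r : ℝ => r ^ forestOrder f) l).const_mul_left _

theorem RTree.one_le_order (h : RTree d) : 1 ≤ h.order := by
  rw [h.order_eq]; omega

theorem isBigO_iteratedFDeriv_apply {E F : Type} [NormedAddCommGroup E] [NormedSpace ℝ E]
    [NormedAddCommGroup F] [NormedSpace ℝ F] {M p : ℕ} {g : E → F}
    (hg : ContDiff ℝ (M : WithTop ℕ∞) g) (hp : p ≤ M) {l : Filter ℝ} {y₀ : E} {y : ℝ → E}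
    (hy : Tendsto y l (𝓝 y₀)) {v : ℝ → Fin p → E}
    (hv : ∀ i, (fun r => v r i) =O[l] fun _ => (1 : ℝ)) :
    (fun r => iteratedFDeriv ℝ p g (y r) (v r)) =O[l] fun _ => (1 : ℝ) := by
  have hc : Continuous (iteratedFDeriv ℝ p g) :=
    hg.continuous_iteratedFDeriv (by exact_mod_cast hp)
  have h1 : (fun r => iteratedFDeriv ℝ p g (y r)) =O[l] fun _ => (1 : ℝ) :=
    ((hc.tendsto y₀).comp hy).isBigO_one ℝ
  have h2 : (fun r => ∏ i, ‖v r i‖) =O[l] fun _ => (1 : ℝ) := by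
    have := IsBigO.finsetProd (s := Finset.univ) (fun i (_ : i ∈ Finset.univ) => (hv i).norm_left)
    simpa using this
  have h3 : (fun r => iteratedFDeriv ℝ p g (y r) (v r)) =O[l]
      fun r => ‖iteratedFDeriv ℝ p g (y r)‖ * ∏ i, ‖v r i‖ :=
    IsBigO.of_norm_le fun r => ContinuousMultilinearMap.le_opNorm _ _
  simpa using h3.trans (h1.norm_left.mul h2)

/-- Evaluating the truncated lift of `g` along a dilation is, up to the order of the truncation,
the same as applying `g` to the evaluation. -/
theorem isLittleO_eval_taylorLift {N M : ℕ} (hM : M < N) {g : State k → State k}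
    (hg : ContDiff ℝ (M : WithTop ℕ∞) g) {l : Filter ℝ} (hl : l ≤ 𝓝 0) {y₀ : State k}
    {y : ℝ → State k} (hy : Tendsto y l (𝓝 y₀)) {Z : ℝ → VecAlg d k}
    (hZ : ∀ h ∈ treesLE d (N - 1),
      (fun r => applyVec (coef {h}) (Z r)) =O[l] fun _ => (1 : ℝ)) (x : RTree d → ℝ) :
    (fun r => g (y r + ∑ h ∈ treesLE d (N - 1), scaleVal r x h • applyVec (coef {h}) (Z r)) -
      applyVec (evalAlg (scaleVal r x)).toLinearMap (projVec M (taylorLift N g (y r) (Z r))))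
      =o[l] fun r => r ^ M := by
  set s := treesLE d (N - 1) with hs
  set b : ℝ → State k := fun r => ∑ h ∈ s, scaleVal r x h • applyVec (coef {h}) (Z r) with hb
  have hbO : b =O[l] fun r => r := by
    refine IsBigO.fun_sum fun h hh => ?_
    have h1 := ((isBigO_scaleVal x h l).trans (isBigO_pow_of_le hl h.one_le_order)).smul (hZ h hh)
    simpa using h1
  have h1 := isLittleO_taylor hg hl hy hbO
  -- The part of the Taylor polynomial removed by the projection: forests of order above `M` carry
  -- at least `r ^ (M + 1)`.
  have h2 : (fun r => ∑ p ∈ Finset.range (M + 1),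
      ((p.factorial : ℝ)⁻¹) • ∑ h ∈ Fintype.piFinset fun _ : Fin p => s,
        (if forestOrder (Finset.univ.val.map h) ≤ M then (0 : State k) else
          evalAlg (scaleVal r x) (ofForest (Finset.univ.val.map h)) •
            iteratedFDeriv ℝ p g (y r) fun i => applyVec (coef {h i}) (Z r)))
      =o[l] fun r => r ^ M := by
    refine IsLittleO.fun_sum fun p hp => ?_
    have hq : (fun r => ∑ h ∈ Fintype.piFinset fun _ : Fin p => s,
        (if forestOrder (Finset.univ.val.map h) ≤ M then (0 : State k) else
          evalAlg (scaleVal r x) (ofForest (Finset.univ.val.map h)) •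
            iteratedFDeriv ℝ p g (y r) fun i => applyVec (coef {h i}) (Z r)))
        =o[l] fun r => r ^ M := by
      refine IsLittleO.fun_sum fun h hh => ?_
      split_ifs with hle
      · exact isLittleO_zero _ _
      · have h3 : (fun r : ℝ => r ^ (M + 1)) =o[l] fun r => r ^ M :=
          (isLittleO_pow_pow (Nat.lt_succ_self M)).mono hl
        refine IsBigO.trans_isLittleO ?_ h3
        have h4 := ((isBigO_evalAlg_scaleVal x (Finset.univ.val.map h) l).trans
          (isBigO_pow_of_le hl (Nat.lt_of_not_le hle))).smul
          (isBigO_iteratedFDeriv_apply hg (Nat.lt_succ_iff.1 (Finset.mem_range.1 hp)) hy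
            (v := fun r i => applyVec (coef {h i}) (Z r))
            fun i => hZ _ (Fintype.mem_piFinset.1 hh i))
        simpa using h4
    exact hq.const_smul_left ((p.factorial : ℝ)⁻¹)
  refine (h1.add h2).congr_left fun r => ?_
  rw [sub_add, sub_right_inj]
  rw [taylorLift, applyVec_projVec, applyVec_sum,
    ← Finset.sum_subset (Finset.range_subset_range.2 (Nat.succ_le_of_lt hM)), ← Finset.sum_sub_distrib]
  · refine Finset.sum_congr rfl fun p _ => ?_
    rw [applyVec_smul, ← smul_sub, applyVec_derivExpansion]
    congr 1
    have hexp : (iteratedFDeriv ℝ p g (y r) fun _ => b r) =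
        ∑ h ∈ Fintype.piFinset fun _ : Fin p => s,
          evalAlg (scaleVal r x) (ofForest (Finset.univ.val.map h)) •
            iteratedFDeriv ℝ p g (y r) fun i => applyVec (coef {h i}) (Z r) := by
      simp only [hb]
      rw [ContinuousMultilinearMap.map_sum_finset]
      refine Finset.sum_congr rfl fun h _ => ?_
      rw [ContinuousMultilinearMap.map_smul_univ, evalAlg_ofForest, Multiset.map_map]
      rfl
    rw [hexp, ← Finset.sum_sub_distrib]
    refine Finset.sum_congr rfl fun h _ => ?_
    simp only [LinearMap.comp_apply, proj_ofForest]
    split_ifs <;> simp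
  -- A product of `p > M` trees has order above `M`, so the projection kills it. Derivatives of `g`
  -- beyond its regularity therefore never matter.
  · intro p _ hp
    rw [applyVec_smul, applyVec_derivExpansion, Finset.sum_eq_zero, smul_zero]
    intro h _
    rw [LinearMap.comp_apply, proj_ofForest, if_neg, map_zero, zero_smul]
    have := card_le_forestOrder (Finset.univ.val.map h)
    simp only [Multiset.card_map, Finset.card_val, Finset.card_univ, Fintype.card_fin] at this
    rw [Finset.mem_range] at hp
    omega

/-! ### Smoothness of the elementary differentials -/

theorem contDiff_multilinear_apply {E F G : Type} [NormedAddCommGroup E] [NormedSpace ℝ E]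
    [NormedAddCommGroup F] [NormedSpace ℝ F] [NormedAddCommGroup G] [NormedSpace ℝ G] {p : ℕ}
    {n : WithTop ℕ∞} {L : E → ContinuousMultilinearMap ℝ (fun _ : Fin p => F) G}
    (hL : ContDiff ℝ n L) {v : E → Fin p → F} (hv : ∀ i, ContDiff ℝ n fun y => v y i) :
    ContDiff ℝ n fun y => L y (v y) := by
  induction p with
  | zero =>
    have h1 : (fun y => L y (v y)) =
        fun y => (continuousMultilinearCurryFin0 ℝ F G) (L y) := by
      funext y
      rw [continuousMultilinearCurryFin0_apply]
      congr 1
      exact Subsingleton.elim _ _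
    rw [h1]
    exact (continuousMultilinearCurryFin0 ℝ F G).contDiff.comp hL
  | succ p ih =>
    let e := continuousMultilinearCurryLeftEquiv ℝ (fun _ : Fin (p + 1) => F) G
    have h1 : (fun y => L y (v y)) = fun y => (e (L y) (v y 0)) (Fin.tail (v y)) := by
      funext y
      change L y (v y) = L y (Fin.cons (v y 0) (Fin.tail (v y)))
      rw [Fin.cons_self_tail]
    rw [h1]
    exact ih ((e.contDiff.comp hL).clm_apply (hv 0)) fun i => hv i.succ

theorem contDiff_forestElemDiff_of_trees {n : ℕ} {σ : Fin d → State k → State k} {μ : Fin d}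
    {f : Forest d} (hσ : ContDiff ℝ ((n + f.card : ℕ) : WithTop ℕ∞) (σ μ))
    (hf : ∀ h ∈ f, ContDiff ℝ (n : WithTop ℕ∞) (h.elemDiff σ)) :
    ContDiff ℝ (n : WithTop ℕ∞) (forestElemDiff σ μ f) := by
  have hlen : f.toList.length = f.card := Multiset.length_toList f
  have heq : forestElemDiff σ μ f = fun y =>
      iteratedFDeriv ℝ f.toList.length (σ μ) y fun i => (f.toList.get i).elemDiff σ y := by
    funext y
    rw [← symDeriv_eq_iteratedFDeriv (hσ.of_le (by rw [hlen]; exact_mod_cast Nat.le_add_left _ _)),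
      forestElemDiff]
    congr 1
    have : (Finset.univ.val.map f.toList.get) = f := by
      rw [Fin.univ_val_map, List.ofFn_get, Multiset.coe_toList]
    conv_lhs => rw [← this, Multiset.map_map]
    rfl
  rw [heq]
  have h1 : ContDiff ℝ (n : WithTop ℕ∞) (iteratedFDeriv ℝ f.toList.length (σ μ)) :=
    hσ.iteratedFDeriv_right (by rw [hlen]; push_cast; rfl)
  exact contDiff_multilinear_apply h1 fun i =>
    hf _ (Multiset.mem_toList.1 (List.get_mem _ _))

/-- Derivative count: a root with `#f` children uses `#f ≤ |f|` derivatives of `σ μ`, so `n + |f| ≤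
N - 1` leaves `n` of them, and the children have smaller order. -/
theorem contDiff_elemDiff {N : ℕ} {σ : Fin d → State k → State k}
    (hσ : ∀ μ, ContDiff ℝ ((N - 1 : ℕ) : WithTop ℕ∞) (σ μ)) (h : RTree d) (n : ℕ)
    (hn : n + h.order ≤ N) : ContDiff ℝ (n : WithTop ℕ∞) (h.elemDiff σ) := by
  induction h using RTree.induction generalizing n with
  | step μ f ih =>
    rw [RTree.order_node] at hn
    rw [RTree.elemDiff_node]
    have := card_le_forestOrder f
    refine contDiff_forestElemDiff_of_trees ((hσ μ).of_le (by exact_mod_cast (by omega)))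
      fun h hh => ih h hh n ?_
    have := RTree.order_le_forestOrder hh
    omega

theorem contDiff_boldUpsilonTree {N : ℕ} {σ : Fin d → State k → State k}
    (hσ : ∀ μ, ContDiff ℝ ((N - 1 : ℕ) : WithTop ℕ∞) (σ μ)) (h : RTree d) (n : ℕ)
    (hn : n + h.order ≤ N) : ContDiff ℝ (n : WithTop ℕ∞) (boldUpsilonTree σ h) :=
  (contDiff_elemDiff hσ h n hn).const_smul _

theorem boldUpsilonTree_node (σ : Fin d → State k → State k) (μ : Fin d) (f : Forest d) :
    boldUpsilonTree σ (RTree.node μ f) = boldUpsilonForest σ μ f := by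
  funext y
  rw [boldUpsilonTree, boldUpsilonForest, RTree.elemDiff_node, RTree.symm_eq,
    RTree.children_node]

theorem contDiff_boldUpsilonForest {N : ℕ} {σ : Fin d → State k → State k}
    (hσ : ∀ μ, ContDiff ℝ ((N - 1 : ℕ) : WithTop ℕ∞) (σ μ)) (μ : Fin d) (f : Forest d) (n : ℕ)
    (hn : n + forestOrder f < N) : ContDiff ℝ (n : WithTop ℕ∞) (boldUpsilonForest σ μ f) := by
  rw [← boldUpsilonTree_node]
  exact contDiff_boldUpsilonTree hσ _ n (by rw [RTree.order_node]; omega)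

theorem coef_boldUpsilon (N : ℕ) (σ : Fin d → State k → State k) (y : State k) {h : RTree d}
    (hh : h ∈ treesLE d (N - 1)) :
    applyVec (coef {h}) (boldUpsilon N σ y) = boldUpsilonTree σ h y := by
  classical
  rw [boldUpsilon, applyVec_sum]
  simp only [applyVec_vecSmul, ofTree, coef_ofForest, Multiset.singleton_inj, ite_smul, one_smul,
    zero_smul]
  rw [Finset.sum_ite_eq', if_pos hh]

end

end BranchedRP

namespace BranchedRP

noncomputable section

open Filter Topology Asymptotics

variable {d k : ℕ}

/-! ### The coproduct -/

/-- The functional `φ ⊗ ψ` on tensors. -/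
def tensorPair (φ ψ : ForestAlg d →ₗ[ℝ] ℝ) : ForestAlg d ⊗[ℝ] ForestAlg d →ₗ[ℝ] ℝ :=
  LinearMap.mul' ℝ ℝ ∘ₗ TensorProduct.map φ ψ

theorem tensorPair_tmul (φ ψ : ForestAlg d →ₗ[ℝ] ℝ) (a b : ForestAlg d) :
    tensorPair φ ψ (a ⊗ₜ b) = φ a * ψ b := by
  simp [tensorPair]

/-- The span of the tensors of forests of total order `m`. -/
def homTensor (d m : ℕ) : Submodule ℝ (ForestAlg d ⊗[ℝ] ForestAlg d) :=
  Submodule.span ℝ {t | ∃ a b : Forest d, forestOrder a + forestOrder b = m ∧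
    t = ofForest a ⊗ₜ ofForest b}

theorem ofForest_tmul_mem_homTensor (a b : Forest d) {m : ℕ}
    (h : forestOrder a + forestOrder b = m) : ofForest a ⊗ₜ ofForest b ∈ homTensor d m :=
  Submodule.subset_span ⟨a, b, h, rfl⟩

theorem mul_mem_homTensor {m n : ℕ} {u v : ForestAlg d ⊗[ℝ] ForestAlg d}
    (hu : u ∈ homTensor d m) (hv : v ∈ homTensor d n) : u * v ∈ homTensor d (m + n) := by
  have h := Submodule.mul_mem_mul hu hv
  rw [homTensor, homTensor, Submodule.span_mul_span] at h
  refine Submodule.span_le.2 ?_ h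
  rintro _ ⟨_, ⟨a, b, h1, rfl⟩, _, ⟨a', b', h2, rfl⟩, rfl⟩
  simp only [Algebra.TensorProduct.tmul_mul_tmul, ← ofForest_add]
  exact ofForest_tmul_mem_homTensor _ _ (by rw [forestOrder_add, forestOrder_add]; omega)

theorem forestOrder_singleton (h : RTree d) : forestOrder {h} = h.order := by
  simp [forestOrder]

theorem forestCoproduct_mem_homTensor_of_trees {f : Forest d}
    (hf : ∀ h ∈ f, h.coproduct ∈ homTensor d h.order) :
    forestCoproduct f ∈ homTensor d (forestOrder f) := by
  induction f using Multiset.induction_on with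
  | empty =>
    simpa [forestCoproduct, ofForest_zero, Algebra.TensorProduct.one_def,
      forestOrder_zero] using ofForest_tmul_mem_homTensor (0 : Forest d) 0 (m := 0) rfl
  | cons t f ih =>
    rw [forestCoproduct, Multiset.map_cons, Multiset.prod_cons, ← Multiset.singleton_add,
      forestOrder_add, forestOrder_singleton]
    exact mul_mem_homTensor (hf t (Multiset.mem_cons_self _ _))
      (ih fun h hh => hf h (Multiset.mem_cons_of_mem hh))

theorem RTree.coproduct_mem_homTensor (h : RTree d) : h.coproduct ∈ homTensor d h.order := by
  induction h using RTree.induction with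
  | step μ f ih =>
    rw [RTree.coproduct_node, RTree.order_node]
    refine add_mem ?_ ?_
    · rw [← ofForest_zero, ofTree]
      exact ofForest_tmul_mem_homTensor _ _
        (by rw [forestOrder_singleton, RTree.order_node, forestOrder_zero])
    · have h1 := Submodule.mem_map_of_mem (f := TensorProduct.map LinearMap.id (graftRoot μ))
        (forestCoproduct_mem_homTensor_of_trees ih)
      rw [homTensor, Submodule.map_span] at h1
      refine Submodule.span_le.2 ?_ h1
      rintro _ ⟨_, ⟨a, b, hab, rfl⟩, rfl⟩
      rw [TensorProduct.map_tmul, LinearMap.id_apply, graftRoot, linExt_ofForest]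
      exact ofForest_tmul_mem_homTensor _ _
        (by rw [forestOrder_singleton, RTree.order_node]; omega)

theorem forestCoproduct_mem_homTensor (f : Forest d) :
    forestCoproduct f ∈ homTensor d (forestOrder f) :=
  forestCoproduct_mem_homTensor_of_trees fun h _ => h.coproduct_mem_homTensor

theorem eqOn_homTensor {M : Type} [AddCommGroup M] [Module ℝ M] {m : ℕ}
    {F G : ForestAlg d ⊗[ℝ] ForestAlg d →ₗ[ℝ] M}
    (h : ∀ a b : Forest d, forestOrder a + forestOrder b = m →
      F (ofForest a ⊗ₜ ofForest b) = G (ofForest a ⊗ₜ ofForest b))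
    {t : ForestAlg d ⊗[ℝ] ForestAlg d} (ht : t ∈ homTensor d m) : F t = G t := by
  refine LinearMap.eqOn_span (s := {t | ∃ a b : Forest d, forestOrder a + forestOrder b = m ∧
    t = ofForest a ⊗ₜ ofForest b}) ?_ ht
  rintro _ ⟨a, b, hab, rfl⟩
  exact h a b hab

theorem tensorPair_congr_left {φ φ' : ForestAlg d →ₗ[ℝ] ℝ} (ψ : ForestAlg d →ₗ[ℝ] ℝ) {n : ℕ}
    (h : ∀ a : Forest d, forestOrder a ≤ n → φ (ofForest a) = φ' (ofForest a)) {g : Forest d}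
    (hg : forestOrder g ≤ n) :
    tensorPair φ ψ (forestCoproduct g) = tensorPair φ' ψ (forestCoproduct g) :=
  eqOn_homTensor (fun a b hab => by
    rw [tensorPair_tmul, tensorPair_tmul, h a (by omega)]) (forestCoproduct_mem_homTensor g)

/-- Expansion of `ψ` over forests in the right factor. The sum over order at most `n` is complete
because the coproduct preserves total order. -/
theorem tensorPair_eq_sum_coef (φ ψ : ForestAlg d →ₗ[ℝ] ℝ) {n : ℕ} {g : Forest d}
    (hg : forestOrder g ≤ n) :
    tensorPair φ ψ (forestCoproduct g) =
      ∑ f ∈ forestsLE d n, tensorPair φ (coef f) (forestCoproduct g) * ψ (ofForest f) := by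
  classical
  have := eqOn_homTensor (F := tensorPair φ ψ)
    (G := ∑ f ∈ forestsLE d n, ψ (ofForest f) • tensorPair φ (coef f)) (fun a b hab => by
      rw [LinearMap.sum_apply]
      simp only [LinearMap.smul_apply, tensorPair_tmul, coef_ofForest, smul_eq_mul, mul_ite,
        mul_one, mul_zero]
      rw [Finset.sum_ite_eq, if_pos (mem_forestsLE.2 (by omega)), mul_comm])
    (forestCoproduct_mem_homTensor g)
  rw [this, LinearMap.sum_apply]
  simp only [LinearMap.smul_apply, smul_eq_mul, mul_comm]

theorem tensorPair_coproduct_node (φ ψ : ForestAlg d →ₗ[ℝ] ℝ) (μ : Fin d) (f : Forest d) :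
    tensorPair φ ψ (RTree.node μ f).coproduct = φ (ofTree (RTree.node μ f)) * ψ 1 +
      tensorPair φ (ψ ∘ₗ graftRoot μ) (forestCoproduct f) := by
  rw [RTree.coproduct_node, map_add, tensorPair_tmul]
  congr 1
  rw [tensorPair, tensorPair, LinearMap.comp_apply, LinearMap.comp_apply, ← LinearMap.comp_apply
    (TensorProduct.map φ ψ), ← TensorProduct.map_comp, LinearMap.comp_id]

/-- The evaluation at `x` of the forest algebra, as a linear functional. -/
abbrev evalLin (x : RTree d → ℝ) : ForestAlg d →ₗ[ℝ] ℝ := (evalAlg x).toLinearMap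

/-- The convolution of two evaluations. -/
def convVal (x z : RTree d → ℝ) (h : RTree d) : ℝ :=
  tensorPair (evalLin x) (evalLin z) h.coproduct

/-- Multiplicativity of the coproduct: both sides are multiplicative in `f` and agree on trees. -/
theorem evalAlg_convVal (x z : RTree d → ℝ) (f : Forest d) :
    evalAlg (convVal x z) (ofForest f) =
      tensorPair (evalLin x) (evalLin z) (forestCoproduct f) := by
  have h : ∀ t, tensorPair (evalLin x) (evalLin z) t =
      Algebra.TensorProduct.productMap (evalAlg x) (evalAlg z) t := by
    intro t
    induction t using TensorProduct.induction_on with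
    | zero => simp
    | tmul a b => simp [tensorPair_tmul]
    | add a b ha hb => rw [map_add, map_add, ha, hb]
  rw [h, forestCoproduct, map_multiset_prod, Multiset.map_map, evalAlg_ofForest]
  congr 1
  refine Multiset.map_congr rfl fun t _ => ?_
  rw [convVal, h]
  rfl

theorem convVal_scaleVal (r : ℝ) (x z : RTree d → ℝ) (h : RTree d) :
    convVal (scaleVal r x) (scaleVal r z) h = scaleVal r (convVal x z) h := by
  have := eqOn_homTensor (F := tensorPair (evalLin (scaleVal r x)) (evalLin (scaleVal r z)))
    (G := r ^ h.order • tensorPair (evalLin x) (evalLin z)) (fun a b hab => by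
      rw [LinearMap.smul_apply, tensorPair_tmul, tensorPair_tmul]
      simp only [AlgHom.toLinearMap_apply, evalAlg_scaleVal, ← hab, smul_eq_mul]
      ring) h.coproduct_mem_homTensor
  exact this

theorem scaleVal_one (x : RTree d → ℝ) : scaleVal 1 x = x := by
  funext h; simp [scaleVal]

/-! ### Polynomial functions of a real variable -/

/-- `F` is a polynomial function of degree at most `n`. -/
def IsPolyLE {E : Type} [AddCommGroup E] [Module ℝ E] (n : ℕ) (F : ℝ → E) : Prop :=
  ∃ c : ℕ → E, ∀ r, F r = ∑ m ∈ Finset.range (n + 1), r ^ m • c m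

namespace IsPolyLE

variable {E : Type} [NormedAddCommGroup E] [NormedSpace ℝ E]

theorem monomial {n m : ℕ} (h : m ≤ n) (v : E) : IsPolyLE n fun r => r ^ m • v := by
  classical
  refine ⟨fun i => if i = m then v else 0, fun r => ?_⟩
  simp only [smul_ite, smul_zero]
  rw [Finset.sum_ite_eq', if_pos (Finset.mem_range.2 (by omega))]

theorem sum {ι : Type} {n : ℕ} (s : Finset ι) {F : ι → ℝ → E} (h : ∀ i ∈ s, IsPolyLE n (F i)) :
    IsPolyLE n fun r => ∑ i ∈ s, F i r := by
  choose! c hc using h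
  refine ⟨fun m => ∑ i ∈ s, c i m, fun r => ?_⟩
  simp only [Finset.smul_sum]
  rw [Finset.sum_comm]
  exact Finset.sum_congr rfl fun i hi => hc i hi r

theorem sub {n : ℕ} {F G : ℝ → E} (hF : IsPolyLE n F) (hG : IsPolyLE n G) :
    IsPolyLE n fun r => F r - G r := by
  obtain ⟨c, hc⟩ := hF
  obtain ⟨c', hc'⟩ := hG
  refine ⟨c - c', fun r => ?_⟩
  simp [hc, hc', smul_sub, Finset.sum_sub_distrib]

/-- The coefficients vanish successively from the lowest: once those below `m` are zero, `r ^ m • c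
m` is itself `o(r ^ m)`, which forces `c m = 0`. -/
theorem eq_zero_of_isLittleO {n : ℕ} {F : ℝ → E} (hF : IsPolyLE n F)
    (ho : F =o[𝓝[≠] 0] fun r => r ^ n) (r : ℝ) : F r = 0 := by
  obtain ⟨c, hc⟩ := hF
  have h0 : ∀ m ≤ n, c m = 0 := by
    intro m
    induction m using Nat.strong_induction_on with
    | _ m ih =>
      intro hm
      have h1 : F =o[𝓝[≠] 0] fun r => r ^ m :=
        ho.trans_isBigO (isBigO_pow_of_le nhdsWithin_le_nhds hm)
      have h2 : ∀ r, F r = r ^ m • c m + ∑ i ∈ Finset.Ico (m + 1) (n + 1), r ^ i • c i := by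
        intro r
        rw [hc, ← Finset.sum_range_add_sum_Ico _ (show m + 1 ≤ n + 1 by omega),
          Finset.sum_range_succ, Finset.sum_eq_zero, zero_add]
        intro i hi
        rw [Finset.mem_range] at hi
        rw [ih i hi (by omega), smul_zero]
      have h3 : (fun r : ℝ => ∑ i ∈ Finset.Ico (m + 1) (n + 1), r ^ i • c i)
          =o[𝓝[≠] 0] fun r => r ^ m := by
        refine IsLittleO.fun_sum fun i hi => ?_
        have h4 : (fun r : ℝ => r ^ i) =o[𝓝[≠] 0] fun r => r ^ m :=
          (isLittleO_pow_pow (Finset.mem_Ico.1 hi).1).mono nhdsWithin_le_nhds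
        simpa using h4.smul_isBigO (isBigO_refl (fun _ => c i) _ |>.trans
          (isBigO_const_const (c i) (one_ne_zero (α := ℝ)) _))
      have h5 : (fun r : ℝ => r ^ m • c m) =o[𝓝[≠] 0] fun r => r ^ m :=
        (h1.sub h3).congr_left fun r => by rw [h2, add_sub_cancel_right]
      by_contra hne
      have h6 : (fun r : ℝ => r ^ m) =o[𝓝[≠] 0] fun r => r ^ m := by
        refine IsBigO.trans_isLittleO ?_ h5
        refine IsBigO.of_bound ‖c m‖⁻¹ (Eventually.of_forall fun r => ?_)
        rw [norm_smul]
        have : ‖c m‖ ≠ 0 := norm_ne_zero_iff.2 hne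
        field_simp
        rfl
      have h7 := isLittleO_irrefl (f'' := fun r : ℝ => r ^ m) (l := 𝓝[≠] 0)
        (Eventually.frequently (by
          filter_upwards [self_mem_nhdsWithin] with r hr
          exact pow_ne_zero _ hr))
      exact h7 h6
  rw [hc]
  exact Finset.sum_eq_zero fun m hm => by
    rw [h0 m (by rw [Finset.mem_range] at hm; omega), smul_zero]

end IsPolyLE

theorem eq_zero_of_sum_evalAlg_smul_eq_zero {s : Finset (Forest d)} {c : Forest d → State k}
    (h : ∀ z : RTree d → ℝ, ∑ f ∈ s, evalAlg z (ofForest f) • c f = 0) {f : Forest d}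
    (hf : f ∈ s) : c f = 0 := by
  classical
  ext j
  have h1 : ∑ g ∈ s, c g j • ofForest g = 0 := by
    refine eq_zero_of_evalAlg_eq_zero fun z => ?_
    have := congrArg (fun v : State k => v j) (h z)
    simpa [mul_comm] using this
  have h2 := congrArg (coef f) h1
  rw [map_sum] at h2
  simp only [map_smul, coef_ofForest, smul_eq_mul, mul_ite, mul_one, mul_zero, map_zero] at h2
  rw [Finset.sum_ite_eq', if_pos hf] at h2
  simpa using h2

end

end BranchedRP

namespace BranchedRP

noncomputable section

open Filter Topology Asymptotics

variable {d k : ℕ}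

/-! ### The coproduct of the expansion of a vector field -/

theorem sum_treesLE_succ {A : Type} [AddCommMonoid A] (n : ℕ) (F : RTree d → A) :
    ∑ h ∈ treesLE d (n + 1), F h = ∑ μ, ∑ f ∈ forestsLE d n, F (RTree.node μ f) := by
  rw [← Finset.sum_product']
  refine Finset.sum_nbij' (fun h => (h.root, h.children)) (fun q => RTree.node q.1 q.2) ?_ ?_ ?_
    ?_ ?_
  · intro h hh
    rw [mem_treesLE, h.order_eq] at hh
    simp only [Finset.mem_product, Finset.mem_univ, true_and, mem_forestsLE]
    omega
  · intro q hq
    simp only [Finset.mem_product, Finset.mem_univ, true_and, mem_forestsLE] at hq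
    rw [mem_treesLE, RTree.order_node]
    omega
  · intro h _
    exact h.node_root_children
  · intro q _
    rw [RTree.root_node, RTree.children_node]
  · intro h _
    rw [h.node_root_children]

/-- The pairing of the coproduct of the truncated expansion of `σ_μ` with `ev x ⊗ f`. -/
def coproductCoef (n : ℕ) (σ : Fin d → State k → State k) (μ : Fin d) (y : State k)
    (x : RTree d → ℝ) (f : Forest d) : State k :=
  ∑ g ∈ forestsLE d n,
    tensorPair (evalLin x) (coef f) (forestCoproduct g) • boldUpsilonForest σ μ g y

/-- The evaluation at `x` of the truncated lift of `𝚼_μ[f]`. -/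
def liftEval (N n : ℕ) (σ : Fin d → State k → State k) (μ : Fin d) (y : State k)
    (x : RTree d → ℝ) (f : Forest d) : State k :=
  applyVec (evalLin x) (projVec (n - forestOrder f)
    (taylorLift N (boldUpsilonForest σ μ f) y (boldUpsilon N σ y)))

/-- `y + ∑_h x(h) 𝚼[h](y)`, for the sum over all trees of order less than `N`. -/
def shift (N : ℕ) (σ : Fin d → State k → State k) (x : RTree d → ℝ) (y : State k) : State k :=
  y + ∑ h ∈ treesLE d (N - 1), x h • boldUpsilonTree σ h y

section

variable {N : ℕ} {σ : Fin d → State k → State k}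

theorem tendsto_shift (σ : Fin d → State k → State k) (x : RTree d → ℝ) (y : State k) :
    Tendsto (fun r => shift N σ (scaleVal r x) y) (𝓝[≠] 0) (𝓝 y) := by
  have h1 : Tendsto (fun r => ∑ h ∈ treesLE d (N - 1),
      scaleVal r x h • boldUpsilonTree σ h y) (𝓝[≠] 0)
      (𝓝 (∑ h ∈ treesLE d (N - 1), (0 : ℝ) • boldUpsilonTree σ h y)) := by
    refine tendsto_finsetSum _ fun h _ => Tendsto.smul_const ?_ _
    have h2 : Continuous fun r => scaleVal r x h := by
      unfold scaleVal; fun_prop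
    have h3 := (h2.tendsto 0).mono_left (nhdsWithin_le_nhds (s := {0}ᶜ))
    have h4 : h.order ≠ 0 := by have := h.one_le_order; omega
    simpa [scaleVal, h4] using h3
  simpa [shift] using h1.const_add y

theorem isBigO_boldUpsilonTree (hσ : ∀ μ, ContDiff ℝ ((N - 1 : ℕ) : WithTop ℕ∞) (σ μ))
    {l : Filter ℝ} {y₀ : State k} {y : ℝ → State k} (hy : Tendsto y l (𝓝 y₀)) {h : RTree d}
    (hh : h.order ≤ N) : (fun r => boldUpsilonTree σ h (y r)) =O[l] fun _ => (1 : ℝ) := by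
  have hc : Continuous (boldUpsilonTree σ h) :=
    (contDiff_boldUpsilonTree hσ h 0 (by omega)).continuous
  exact ((hc.tendsto y₀).comp hy).isBigO_one ℝ

/-- Taylor's formula for the lift of a function to the expansion `𝚼(y)`. -/
theorem isLittleO_shift_sub_eval (hN : 1 ≤ N)
    (hσ : ∀ μ, ContDiff ℝ ((N - 1 : ℕ) : WithTop ℕ∞) (σ μ)) {M : ℕ} (hM : M < N)
    {g : State k → State k} (hg : ContDiff ℝ (M : WithTop ℕ∞) g) {y₀ : State k}
    {y : ℝ → State k} (hy : Tendsto y (𝓝[≠] 0) (𝓝 y₀)) (x : RTree d → ℝ) :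
    (fun r => g (shift N σ (scaleVal r x) (y r)) -
      applyVec (evalLin (scaleVal r x))
        (projVec M (taylorLift N g (y r) (boldUpsilon N σ (y r))))) =o[𝓝[≠] 0]
      fun r => r ^ M := by
  refine (isLittleO_eval_taylorLift hM hg nhdsWithin_le_nhds hy
    (Z := fun r => boldUpsilon N σ (y r)) (fun h hh => ?_) x).congr_left fun r => ?_
  · simp only [coef_boldUpsilon N σ _ hh]
    exact isBigO_boldUpsilonTree hσ hy (by rw [mem_treesLE] at hh; omega)
  · rw [shift]
    congr 3
    exact Finset.sum_congr rfl fun h hh => by rw [coef_boldUpsilon N σ _ hh]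

/-- Trees of order above `n` carry a power of `r` higher than `n`, so `shift` may be truncated at
order `n`. -/
theorem isLittleO_sum_treesLE_sub {n : ℕ} (hn : n ≤ N - 1) (x : RTree d → ℝ)
    {F : ℝ → RTree d → State k}
    (hF : ∀ h ∈ treesLE d (N - 1), (fun r => F r h) =O[𝓝[≠] 0] fun _ => (1 : ℝ)) :
    (fun r => ∑ h ∈ treesLE d (N - 1), scaleVal r x h • F r h -
      ∑ h ∈ treesLE d n, scaleVal r x h • F r h) =o[𝓝[≠] 0] fun r => r ^ n := by
  classical
  have hsub : treesLE d n ⊆ treesLE d (N - 1) := fun h hh =>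
    mem_treesLE.2 ((mem_treesLE.1 hh).trans hn)
  have h1 : (fun r => ∑ h ∈ treesLE d (N - 1) \ treesLE d n, scaleVal r x h • F r h)
      =o[𝓝[≠] 0] fun r => r ^ n := by
    refine IsLittleO.fun_sum fun h hh => ?_
    rw [Finset.mem_sdiff, mem_treesLE (n := n), not_le] at hh
    have h2 : (fun r => scaleVal r x h) =o[𝓝[≠] 0] fun r => r ^ n :=
      (isBigO_scaleVal x h _).trans_isLittleO
        ((isLittleO_pow_pow hh.2).mono nhdsWithin_le_nhds)
    simpa using h2.smul_isBigO (hF h hh.1)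
  refine h1.congr_left fun r => ?_
  rw [eq_sub_iff_add_eq, Finset.sum_sdiff hsub]

/-- If the coproduct of the expansion is known up to order `n - 1`, then, up to order `n`, the
convolution of two shifts is their composition. -/
theorem isLittleO_shift_convVal (hN : 1 ≤ N)
    (hσ : ∀ μ, ContDiff ℝ ((N - 1 : ℕ) : WithTop ℕ∞) (σ μ)) {n : ℕ} (hn : n ≤ N - 1)
    (y : State k)
    (ih : ∀ m < n, ∀ μ x, ∀ f ∈ forestsLE d m,
      coproductCoef m σ μ y x f = liftEval N m σ μ y x f) (x z : RTree d → ℝ) :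
    (fun r => shift N σ (scaleVal r (convVal x z)) y -
      shift N σ (scaleVal r z) (shift N σ (scaleVal r x) y)) =o[𝓝[≠] 0] fun r => r ^ n := by
  have hy := tendsto_shift (N := N) σ x y
  have hO : ∀ h ∈ treesLE d (N - 1), (fun r : ℝ => boldUpsilonTree σ h y) =O[𝓝[≠] 0]
      fun _ => (1 : ℝ) := fun h hh =>
    isBigO_boldUpsilonTree hσ tendsto_const_nhds (by rw [mem_treesLE] at hh; omega)
  have hO' : ∀ h ∈ treesLE d (N - 1),
      (fun r : ℝ => boldUpsilonTree σ h (shift N σ (scaleVal r x) y)) =O[𝓝[≠] 0]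
      fun _ => (1 : ℝ) := fun h hh =>
    isBigO_boldUpsilonTree hσ hy (by rw [mem_treesLE] at hh; omega)
  have h1 := isLittleO_sum_treesLE_sub hn (convVal x z) hO
  have h2 := isLittleO_sum_treesLE_sub hn x hO
  have h3 := isLittleO_sum_treesLE_sub hn z hO'
  have key : (fun r => ∑ h ∈ treesLE d n, scaleVal r (convVal x z) h • boldUpsilonTree σ h y -
      (∑ h ∈ treesLE d n, scaleVal r x h • boldUpsilonTree σ h y +
        ∑ h ∈ treesLE d n, scaleVal r z h •
          boldUpsilonTree σ h (shift N σ (scaleVal r x) y))) =o[𝓝[≠] 0] fun r => r ^ n := by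
    cases n with
    | zero =>
      have hemp : treesLE d 0 = ∅ := Finset.eq_empty_of_forall_notMem fun h hh => by
        have := h.one_le_order
        rw [mem_treesLE] at hh
        omega
      simp only [hemp, Finset.sum_empty, add_zero, sub_zero]
      exact isLittleO_zero _ _
    | succ m =>
      -- The weight of `[f]_μ` supplies `r ^ (|f| + 1)`, so Taylor accuracy `o(r ^ (m - |f|))` for
      -- `𝚼_μ[f]` suffices. The root node is the gain of one order that lets the induction advance.
      have hmain : ∀ μ : Fin d, ∀ f ∈ forestsLE d m,
          (fun r => scaleVal r z (RTree.node μ f) • (liftEval N m σ μ y (scaleVal r x) f -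
            boldUpsilonForest σ μ f (shift N σ (scaleVal r x) y))) =o[𝓝[≠] 0]
            fun r => r ^ (m + 1) := by
        intro μ f hf
        rw [mem_forestsLE] at hf
        have h4 := isLittleO_shift_sub_eval hN hσ (M := m - forestOrder f) (by omega)
          (contDiff_boldUpsilonForest hσ μ f (m - forestOrder f) (by omega))
          (tendsto_const_nhds (x := y)) x
        have h5 := (isBigO_scaleVal z (RTree.node μ f) (𝓝[≠] 0)).smul_isLittleO h4.neg_left
        refine (h5.congr_left fun r => ?_).congr_right fun r => ?_
        · rw [neg_sub]; rfl
        · rw [smul_eq_mul, ← pow_add, RTree.order_node]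
          congr 1
          omega
      have hsum : (fun r => ∑ μ, ∑ f ∈ forestsLE d m,
          scaleVal r z (RTree.node μ f) • (liftEval N m σ μ y (scaleVal r x) f -
            boldUpsilonForest σ μ f (shift N σ (scaleVal r x) y))) =o[𝓝[≠] 0]
            fun r => r ^ (m + 1) :=
        IsLittleO.fun_sum fun μ _ => IsLittleO.fun_sum fun f hf => hmain μ f hf
      refine hsum.congr_left fun r => ?_
      rw [sum_treesLE_succ, sum_treesLE_succ, sum_treesLE_succ, ← Finset.sum_add_distrib,
        ← Finset.sum_sub_distrib]
      refine Finset.sum_congr rfl fun μ _ => ?_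
      simp only [boldUpsilonTree_node, smul_sub, Finset.sum_sub_distrib]
      rw [← sub_sub]
      congr 1
      rw [eq_sub_iff_add_eq']
      symm
      -- The recursion for `Δ[f]_μ`: the summand `[f]_μ ⊗ 1` rebuilds the shift by `x`. After
      -- exchanging sums, the other summand becomes `coproductCoef` at order `m`, to which the
      -- hypothesis `ih` applies.
      have h6 : ∀ f ∈ forestsLE d m, scaleVal r (convVal x z) (RTree.node μ f) =
          scaleVal r x (RTree.node μ f) +
            ∑ f' ∈ forestsLE d m, tensorPair (evalLin (scaleVal r x)) (coef f')
              (forestCoproduct f) * scaleVal r z (RTree.node μ f') := by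
        intro f hf
        rw [← convVal_scaleVal, convVal, tensorPair_coproduct_node,
          tensorPair_eq_sum_coef _ _ (mem_forestsLE.1 hf)]
        simp only [LinearMap.comp_apply, graftRoot, linExt_ofForest, AlgHom.toLinearMap_apply,
          evalAlg_ofTree, map_one, mul_one]
      rw [Finset.sum_congr rfl fun f hf => by rw [h6 f hf, add_smul, Finset.sum_smul],
        Finset.sum_add_distrib]
      congr 1
      rw [Finset.sum_comm]
      refine Finset.sum_congr rfl fun f' hf' => ?_
      rw [← ih m (Nat.lt_succ_self m) μ (scaleVal r x) f' hf', coproductCoef, Finset.smul_sum]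
      refine Finset.sum_congr rfl fun f _ => ?_
      rw [smul_smul, mul_comm]
  refine (((h1.add key).sub h2).sub h3).congr_left fun r => ?_
  simp only [shift]
  abel

theorem sum_evalAlg_smul_boldUpsilonForest
    (hσ : ∀ μ, ContDiff ℝ ((N - 1 : ℕ) : WithTop ℕ∞) (σ μ)) {n : ℕ} (hn : n < N)
    (φ : ForestAlg d →ₗ[ℝ] ℝ) (μ : Fin d) (y : State k) :
    ∑ g ∈ forestsLE d n, φ (ofForest g) • boldUpsilonForest σ μ g y =
      applyVec φ (projVec n (taylorLift N (σ μ) y (boldUpsilon N σ y))) := by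
  rw [applyVec_projVec_eq_sum]
  refine Finset.sum_congr rfl fun g hg => ?_
  rw [mem_forestsLE] at hg
  rw [coef_taylorLift (hσ μ) (by omega)]
  intro h hh
  refine coef_boldUpsilon N σ y (mem_treesLE.2 ?_)
  have := RTree.order_le_forestOrder hh
  omega

/-- The coefficients of the coproduct of the truncated expansion of `σ_μ` are the lifts of the
elementary differentials. -/
theorem coproductCoef_eq_liftEval (hN : 1 ≤ N)
    (hσ : ∀ μ, ContDiff ℝ ((N - 1 : ℕ) : WithTop ℕ∞) (σ μ)) (y : State k) {n : ℕ}
    (hn : n < N) (μ : Fin d) (x : RTree d → ℝ) {f : Forest d} (hf : f ∈ forestsLE d n) :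
    coproductCoef n σ μ y x f = liftEval N n σ μ y x f := by
  induction n using Nat.strong_induction_on generalizing μ x f with
  | _ n ih =>
    rw [← sub_eq_zero]
    -- It suffices to test against every evaluation `z` in the right tensor factor, which couples
    -- all forests `f` at once.
    refine eq_zero_of_sum_evalAlg_smul_eq_zero
      (c := fun f => coproductCoef n σ μ y x f - liftEval N n σ μ y x f) (fun z => ?_) hf
    have hσn : ContDiff ℝ (n : WithTop ℕ∞) (σ μ) :=
      (hσ μ).of_le (by exact_mod_cast (by omega))
    have hy := tendsto_shift (N := N) σ x y
    have hshift := isLittleO_shift_convVal hN hσ (n := n) (by omega) y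
      (fun m hm μ x f hf => ih m hm (by omega) μ x hf) x z
    -- `σ μ` at the shift by the convolution and at the composed shift: `hA` and `hB` expand the two
    -- values, the second at the moving base point, and `hAB` compares them.
    have hA := isLittleO_shift_sub_eval hN hσ hn hσn (tendsto_const_nhds (x := y)) (convVal x z)
    have hB := isLittleO_shift_sub_eval hN hσ hn hσn hy z
    have hAB := isLittleO_perturb hσn nhdsWithin_le_nhds
      (tendsto_shift (N := N) σ (convVal x z) y) (hshift.neg_left.congr_left fun r => neg_sub _ _)
    -- The moving base point is re-expanded at `y`; the weight `r ^ |f|` compensates for the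
    -- regularity `n - |f|` of `𝚼_μ[f]`.
    have hC : (fun r => ∑ f ∈ forestsLE d n, evalAlg (scaleVal r z) (ofForest f) •
        (boldUpsilonForest σ μ f (shift N σ (scaleVal r x) y) -
          liftEval N n σ μ y (scaleVal r x) f)) =o[𝓝[≠] 0] fun r => r ^ n := by
      refine IsLittleO.fun_sum fun f hf => ?_
      rw [mem_forestsLE] at hf
      have h4 := isLittleO_shift_sub_eval hN hσ (M := n - forestOrder f) (by omega)
        (contDiff_boldUpsilonForest hσ μ f (n - forestOrder f) (by omega))
        (tendsto_const_nhds (x := y)) x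
      refine ((isBigO_evalAlg_scaleVal z f (𝓝[≠] 0)).smul_isLittleO h4).congr_right fun r => ?_
      rw [smul_eq_mul, ← pow_add]
      congr 1
      omega
    have hD : (fun r => ∑ g ∈ forestsLE d n,
          evalAlg (scaleVal r (convVal x z)) (ofForest g) • boldUpsilonForest σ μ g y -
        ∑ f ∈ forestsLE d n, evalAlg (scaleVal r z) (ofForest f) •
          liftEval N n σ μ y (scaleVal r x) f) =o[𝓝[≠] 0] fun r => r ^ n := by
      refine (((hB.sub hA).sub hAB).add hC).congr_left fun r => ?_
      have e1 := sum_evalAlg_smul_boldUpsilonForest hσ hn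
        (evalLin (scaleVal r (convVal x z))) μ y
      have e2 := sum_evalAlg_smul_boldUpsilonForest hσ hn
        (evalLin (scaleVal r z)) μ (shift N σ (scaleVal r x) y)
      simp only [AlgHom.toLinearMap_apply] at e1 e2
      simp only [smul_sub, Finset.sum_sub_distrib]
      rw [← e1, ← e2]
      abel
    have hpoly : IsPolyLE n fun r => ∑ g ∈ forestsLE d n,
          evalAlg (scaleVal r (convVal x z)) (ofForest g) • boldUpsilonForest σ μ g y -
        ∑ f ∈ forestsLE d n, evalAlg (scaleVal r z) (ofForest f) •
          liftEval N n σ μ y (scaleVal r x) f := by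
      refine (IsPolyLE.sum _ fun g hg => ?_).sub (IsPolyLE.sum _ fun f hf => ?_)
      · simp only [evalAlg_scaleVal, mul_smul]
        exact IsPolyLE.monomial (mem_forestsLE.1 hg) _
      · simp only [liftEval, applyVec_projVec_eq_sum, AlgHom.toLinearMap_apply, Finset.smul_sum,
          evalAlg_scaleVal, smul_smul]
        refine IsPolyLE.sum _ fun a ha => ?_
        rw [mem_forestsLE] at ha hf
        have := IsPolyLE.monomial (n := n) (m := forestOrder f + forestOrder a) (by omega)
          ((evalAlg z (ofForest f) * evalAlg x (ofForest a)) •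
            applyVec (coef a) (taylorLift N (boldUpsilonForest σ μ f) y (boldUpsilon N σ y)))
        convert this using 2 with r
        rw [smul_smul, pow_add]
        congr 1
        ring
    -- The vanishing is exact for all `r`, so the dilation can be removed at `r = 1`.
    have h1 := hpoly.eq_zero_of_isLittleO hD 1
    simp only [scaleVal_one] at h1
    rw [← h1]
    simp only [smul_sub, Finset.sum_sub_distrib]
    congr 1
    simp only [coproductCoef, Finset.smul_sum, smul_smul]
    rw [Finset.sum_comm]
    refine Finset.sum_congr rfl fun g hg => ?_
    rw [evalAlg_convVal, tensorPair_eq_sum_coef _ _ (mem_forestsLE.1 hg), Finset.sum_smul]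
    refine Finset.sum_congr rfl fun f _ => ?_
    rw [mul_comm]
    rfl

end

/-! ### Coherent tree paths -/

/-- Multiplicativity lets a character be replaced by the evaluation at its tree values. The bound on
the trees keeps every factor inside `F`, away from the default value `0` of `pair`. -/
theorem Character.pair_ofForest {N : ℕ} (u : Character d N) {f : Forest d}
    (hf : ∀ h ∈ f, h.order ≤ N) :
    u.pair (ofForest f) = evalAlg (fun h => u.pair (ofTree h)) (ofForest f) := by
  classical
  have hval : ∀ (f : Forest d) (hf : f ∈ boundedForests d N),
      u.pair (ofForest f) = u (AddMonoidAlgebra.single ⟨f, hf⟩ 1) := by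
    intro f hf
    rw [Character.pair, linExt_ofForest, dif_pos hf]
  rw [evalAlg_ofForest]
  induction f using Multiset.induction_on with
  | empty =>
    rw [hval 0 (zero_mem _), Multiset.map_zero, Multiset.prod_zero]
    exact map_one u
  | cons t f ih =>
    have ht : ({t} : Forest d) ∈ boundedForests d N := fun h hh => by
      rw [Multiset.mem_singleton.1 hh]
      exact hf t (Multiset.mem_cons_self _ _)
    have hf' : f ∈ boundedForests d N := fun h hh => hf h (Multiset.mem_cons_of_mem hh)
    rw [Multiset.map_cons, Multiset.prod_cons, ← ih hf', ofTree, hval _ ht, hval _ hf', ← map_mul,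
      AddMonoidAlgebra.single_mul_single, hval (t ::ₘ f) hf, one_mul]
    rfl

theorem coef_compose {N : ℕ} (hN : 1 ≤ N) {σ : Fin d → State k → State k} {μ : Fin d}
    (hσ : ContDiff ℝ ((N - 1 : ℕ) : WithTop ℕ∞) (σ μ)) {Z : VecAlg d k} {f : Forest d}
    (hf : forestOrder f ≤ N - 1)
    (hZ : ∀ h ∈ f, applyVec (coef {h}) Z = boldUpsilonTree σ h (base Z)) :
    applyVec (coef f) (compose N (σ μ) Z) = boldUpsilonForest σ μ f (base Z) := by
  rw [compose_eq_projVec hN, ← coef_taylorLift hσ (by omega) hZ]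
  ext j
  simp [applyVec, projVec, coef_proj, hf]

/-- Coherence equates the coefficient at `[f]_μ` with that of `σ_μ(Y)_s` at `f`, which depends only
on `Y_s` at the trees of `f` and on its base point, so structural induction closes. -/
theorem IsCoherent.coef_tree {N : ℕ} {T : ℝ} (hN : 1 ≤ N) {σ : Fin d → State k → State k}
    (hσ : ∀ μ, ContDiff ℝ ((N - 1 : ℕ) : WithTop ℕ∞) (σ μ))
    {Y : Set.Icc (0 : ℝ) T → VecAlg d k} (hY : IsCoherent N σ Y) {s : Set.Icc (0 : ℝ) T}
    (hs : 0 < (s : ℝ)) (h : RTree d) (hh : h.order ≤ N - 1) :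
    applyVec (coef {h}) (Y s) = boldUpsilonTree σ h (base (Y s)) := by
  induction h using RTree.induction with
  | step μ f ih =>
    rw [← hY μ f (mem_treesLE.2 hh) s hs, boldUpsilonTree_node]
    rw [RTree.order_node] at hh
    refine coef_compose hN (hσ μ) (by omega) fun h hf => ih h hf ?_
    have := RTree.order_le_forestOrder hf
    omega

theorem IsCoherent.applyVec_compose {N : ℕ} {T : ℝ} (hN : 1 ≤ N)
    {σ : Fin d → State k → State k}
    (hσ : ∀ μ, ContDiff ℝ ((N - 1 : ℕ) : WithTop ℕ∞) (σ μ))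
    {Y : Set.Icc (0 : ℝ) T → VecAlg d k} (hY : IsCoherent N σ Y) {s : Set.Icc (0 : ℝ) T}
    (hs : 0 < (s : ℝ)) (μ : Fin d) (φ : ForestAlg d →ₗ[ℝ] ℝ) :
    applyVec φ (compose N (σ μ) (Y s)) =
      ∑ g ∈ forestsLE d (N - 1), φ (ofForest g) • boldUpsilonForest σ μ g (base (Y s)) := by
  rw [compose_eq_projVec hN, applyVec_projVec_eq_sum]
  refine Finset.sum_congr rfl fun g hg => ?_
  rw [mem_forestsLE] at hg
  rw [coef_taylorLift (hσ μ) (by omega)]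
  intro h hh
  exact hY.coef_tree hN hσ hs h ((RTree.order_le_forestOrder hh).trans hg)

end

end BranchedRP

/-! ### The remainder formula -/

theorem corollary3p5 (d k N : ℕ) (hN : 1 ≤ N) (T : ℝ)
    (σ : Fin d → State k → State k)
    (hσ : ∀ μ, ContDiff ℝ ((N - 1 : ℕ) : WithTop ℕ∞) (σ μ))
    (X : CharacterPath d N T)
    (Y : Set.Icc (0 : ℝ) T → VecAlg d k) (hY : IsTreePath N Y) (hcoh : IsCoherent N σ Y)
    (f : Forest d) (hf : f ∈ forestsLE d (N - 1)) (μ : Fin d)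
    (s t : Set.Icc (0 : ℝ) T) (hs : 0 < (s : ℝ)) (ht : 0 < (t : ℝ)) :
    remainder X (fun r => compose N (σ μ) (Y r)) f s t =
      boldUpsilonForest σ μ f (base (Y t)) -
        applyVec (X s t).pair
          (projVec (N - forestOrder f - 1)
            (∑ p ∈ Finset.range N, ((p.factorial : ℝ)⁻¹) •
              derivExpansion (N - 1) p (boldUpsilonForest σ μ f) (base (Y s))
                (boldUpsilon N σ (base (Y s))))) := by

  have hfo : forestOrder f ≤ N - 1 := mem_forestsLE.1 hf
  have hpair : ∀ a : Forest d, forestOrder a ≤ N - 1 → (X s t).pair (ofForest a) =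
      evalLin (fun h => (X s t).pair (ofTree h)) (ofForest a) := fun a ha =>
    (X s t).pair_ofForest fun h hh => (RTree.order_le_forestOrder hh).trans (by omega)
  rw [remainder, hcoh.applyVec_compose hN hσ hs]
  congr 1
  · exact coef_compose hN (hσ μ) hfo fun h hh =>
      hcoh.coef_tree hN hσ ht h ((RTree.order_le_forestOrder hh).trans hfo)
  · have hmain := coproductCoef_eq_liftEval hN hσ (base (Y s)) (n := N - 1) (by omega) μ
      (fun h => (X s t).pair (ofTree h)) hf
    rw [coproductCoef, liftEval, show N - 1 - forestOrder f = N - forestOrder f - 1 by omega,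
      applyVec_projVec_eq_sum] at hmain
    rw [← taylorLift, applyVec_projVec_eq_sum]
    refine Eq.trans (Finset.sum_congr rfl fun g hg => ?_)
      (hmain.trans (Finset.sum_congr rfl fun a ha => ?_))
    · rw [LinearMap.comp_apply, coproduct, linExt_ofForest]
      congr 1
      -- The left factors in the coproduct of `g` have order at most `|g| ≤ N - 1`, where the
      -- character and the evaluation agree.
      exact tensorPair_congr_left (coef f) hpair (mem_forestsLE.1 hg)
    · rw [hpair a ((mem_forestsLE.1 ha).trans (by omega))]
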